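/- Let $T:\mathbb{R}^d\to\mathbb{R}^d$ be a linear contractive similarity, i.e. $|Tx|=r|x|$ for all $x$ with some $r\in(0,1)$; let $a_1,\dots,a_m\in\mathbb{R}^d$, and let $p_1,\dots,p_m>0$ with $\sum_{i=1}^m p_i=1$. Let $\nu$ be the self-similar measure of the homogeneous iterated function system $f_i(x)=Tx+a_i$ with weights $p_i$, i.e. the unique Borel probability measure on $\mathbb{R}^d$ with $\nu=\sum_{i=1}^m p_i\,f_i\nu$, where $f_i\nu(A)=\nu(f_i^{-1}A)$. Suppose that $\nu$ has Hausdorff dimension $d$, i.e. $\inf\{\dim_H A: A \text{ Borel},\ \nu(A)>0\}=d$. Let $\eta$ be a Borel probability measure on $\mathbb{R}^d$ whose Fourier transform $\widehat\eta(\xi)=\int e^{i\pi\langle x,\xi\rangle}\,d\eta(x)$ has power decay: there are $\sigma>0$ and $C$ such that $|\widehat\eta(\xi)|\le C|\xi|^{-\sigma}$ for all $\xi\neq 0$. Then the convolution $\nu*\eta$ is absolutely continuous with respect to Lebesgue measure on $\mathbb{R}^d$, and its density is in $L^q(\mathbb{R}^d)$ for some real $q>1$. -/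

import Mathlib

open MeasureTheory
open scoped ENNReal

/-- `T` is a (linear) contractive similarity of `ℝ^d` with contraction ratio in `(0, 1)`;
since the ratio is positive, `T` is automatically invertible. -/
def IsContractiveSimilarity {d : ℕ}
    (T : EuclideanSpace ℝ (Fin d) →ₗ[ℝ] EuclideanSpace ℝ (Fin d)) : Prop :=
  ∃ r : ℝ, 0 < r ∧ r < 1 ∧ ∀ x, ‖T x‖ = r * ‖x‖

/-- `p` belongs to the open simplex: a probability vector with positive entries. -/
def IsPositiveProbVector {m : ℕ} (p : Fin m → ℝ) : Prop :=
  (∀ i, 0 < p i) ∧ ∑ i, p i = 1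

/-- The probability measure `ν` is the self-similar measure for the homogeneous iterated
function system `(x ↦ T x + a i)` with weights `p`, i.e. the (unique) Borel probability measure
with `ν = ∑ i, p i • f_i ν`, where `f_i ν` is the push-forward of `ν` under `x ↦ T x + a i`. -/
structure IsSelfSimilarMeasure {d m : ℕ}
    (T : EuclideanSpace ℝ (Fin d) →ₗ[ℝ] EuclideanSpace ℝ (Fin d))
    (a : Fin m → EuclideanSpace ℝ (Fin d)) (p : Fin m → ℝ)
    (ν : Measure (EuclideanSpace ℝ (Fin d))) : Prop where
  isProbabilityMeasure : IsProbabilityMeasure ν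
  invariant : ν = ∑ i, ENNReal.ofReal (p i) • ν.map (fun x => T x + a i)

/-- The (lower) Hausdorff dimension of a measure: the infimum of the Hausdorff dimensions of
the Borel sets of positive measure. -/
noncomputable def measureDimH {d : ℕ} (μ : Measure (EuclideanSpace ℝ (Fin d))) : ℝ≥0∞ :=
  ⨅ (A : Set (EuclideanSpace ℝ (Fin d))) (_ : MeasurableSet A) (_ : 0 < μ A), dimH A

/-- The Fourier transform `ξ ↦ ∫ exp(iπ⟨x, ξ⟩) dμ(x)` of a measure. -/
noncomputable def measureFourier {d : ℕ} (μ : Measure (EuclideanSpace ℝ (Fin d)))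
    (ξ : EuclideanSpace ℝ (Fin d)) : ℂ :=
  ∫ x, Complex.exp (Complex.I * (Real.pi : ℂ) * ((inner ℝ x ξ : ℝ) : ℂ)) ∂μ

/-- Power Fourier decay: `|μ̂(ξ)| = O(|ξ|^{-σ})` for some `σ > 0`. The point `ξ = 0`, where
`|ξ|^{-σ}` is infinite, is left out. -/
def HasPowerFourierDecay {d : ℕ} (μ : Measure (EuclideanSpace ℝ (Fin d))) : Prop :=
  ∃ σ : ℝ, 0 < σ ∧ ∃ C : ℝ, ∀ ξ : EuclideanSpace ℝ (Fin d), ξ ≠ 0 →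
    ‖measureFourier μ ξ‖ ≤ C * ‖ξ‖ ^ (-σ)

/-!
Write `d` for the dimension, `r` for the contraction ratio and `μ = ν ∗ η`. The theorem follows from
a power bound `μ(A) ≤ C |A|^θ` with `θ > 0`: it gives absolute continuity at once, and applied to
the superlevel sets of the density `f` it gives `μ(f ≥ t) ≤ C t^(-θ)`, hence `f ∈ L^q` for
`q = 1 + θ / 2` (`absolutelyContinuous_and_memLp_of_measure_le_rpow`).

The power bound comes from splitting `ν`, at each scale, into a part of exponentially small mass and
a part that satisfies a Frostman condition `ν(B(x, R)) ≤ B R^u` with `u < d` as close to `d` as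
desired. For the second part, the decay `|η^(ξ)| ≤ C |ξ|^(-σ)` and `u > d - 2σ` make the Fourier
transform of its convolution with `η` square integrable: `|η^|²` is dominated by a series of
Gaussians, and the Gaussian-weighted `L²` norm of a Fourier transform is an explicit energy
(`lintegral_gaussian_mul_charFun_sq`, `exists_lintegral_charFun_conv_sq_le`). Plancherel's theorem
for test functions and the Cauchy-Schwarz inequality then bound the mass of `A` by a multiple of
`|A|^(1/2)` (`sq_measure_le`), and the power bound results from optimizing the scale
(`exists_conv_apply_le`, `exists_measure_le_rpow`).

What remains is the exponential smallness of the exceptional part, that is, the large deviation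
estimate `ν {x | ν(B(x, ρᵏ)) > ρ^(k u)} ≤ K ρ^(k δ)` (`exists_measure_lt_measure_ball_le`). Full
Hausdorff dimension gives this qualitatively: the mass tends to `0`, because the limsup of these
sets has dimension less than `d` (`tendsto_measure_lt_measure_ball`). Self-similarity upgrades it to
an exponential rate. The moments `I(R) = ∫ ν(B(x, R))^(1 + s) dx` are submultiplicative along the
scales `rⁿ`, up to a constant that is uniform in `s ∈ (0, 1]` (`exists_ballMoment_pow_add_le`). This
allows `s` to be chosen depending on a single scale at which the qualitative statement is good
enough, and iteration yields power decay of `I` with nearly the optimal exponent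
(`exists_ballMoment_pow_le`). Chebyshev's inequality finishes the argument.
-/

namespace SelfSimilarConv

open Metric Set Filter Topology

variable {E : Type*} [NormedAddCommGroup E] [InnerProductSpace ℝ E] [FiniteDimensional ℝ E]
  [MeasurableSpace E] [BorelSpace E]

/-! ### Ball moments and correlation integrals -/

theorem measurable_measure_ball {X : Type*} [PseudoMetricSpace X] [SecondCountableTopology X]
    [MeasurableSpace X] [OpensMeasurableSpace X] (μ : Measure X) [SFinite μ] (R : ℝ) :
    Measurable fun x => μ (ball x R) := by
  have hs : MeasurableSet {p : X × X | dist p.2 p.1 < R} :=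
    (isOpen_lt (by fun_prop) (by fun_prop)).measurableSet
  exact measurable_measure_prodMk_left hs

/-- The moment `∫ ν(B(x, R))^(1 + s) dx` of the ball masses of `ν` with respect to Lebesgue
measure. -/
noncomputable def ballMoment (ν : Measure E) (s R : ℝ) : ℝ≥0∞ :=
  ∫⁻ x, ν (ball x R) ^ (1 + s)

/-- The correlation integral `∫ ν(B(z, R))^s dν(z)`. -/
noncomputable def corrIntegral (ν : Measure E) (s R : ℝ) : ℝ≥0∞ :=
  ∫⁻ z, ν (ball z R) ^ s ∂ν

theorem measurableSet_dist_lt (R : ℝ) : MeasurableSet {p : E × E | dist p.2 p.1 < R} :=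
  (isOpen_lt (by fun_prop) (by fun_prop)).measurableSet

/-- Fubini for a weight that is localized to the pairs of points at distance less than `R`. -/
theorem lintegral_setLIntegral_ball_swap (μ ν : Measure E) [SFinite μ] [SFinite ν]
    {f : E → E → ℝ≥0∞} (hf : Measurable (Function.uncurry f)) (R : ℝ) :
    ∫⁻ x, ∫⁻ y in ball x R, f x y ∂ν ∂μ = ∫⁻ y, ∫⁻ x in ball y R, f x y ∂μ ∂ν := by
  have h1 : ∀ x, ∫⁻ y in ball x R, f x y ∂ν
      = ∫⁻ y, {p : E × E | dist p.2 p.1 < R}.indicator (Function.uncurry f) (x, y) ∂ν := by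
    intro x
    rw [← lintegral_indicator measurableSet_ball]
    rfl
  have h2 : ∀ y, ∫⁻ x in ball y R, f x y ∂μ
      = ∫⁻ x, {p : E × E | dist p.2 p.1 < R}.indicator (Function.uncurry f) (x, y) ∂μ := by
    intro y
    rw [← lintegral_indicator measurableSet_ball]
    refine lintegral_congr fun x => ?_
    simp only [indicator, mem_ball, mem_ofPred_eq, dist_comm x y, Function.uncurry_apply_pair]
  simp_rw [h1, h2]
  exact lintegral_lintegral_swap (hf.indicator (measurableSet_dist_lt R)).aemeasurable

theorem ballMoment_eq (ν : Measure E) [IsFiniteMeasure ν] {s : ℝ} (hs : 0 ≤ s) (R : ℝ) :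
    ballMoment ν s R = ∫⁻ z, ∫⁻ x in ball z R, ν (ball x R) ^ s ∂volume ∂ν := by
  have h : ∀ x, ν (ball x R) ^ (1 + s) = ∫⁻ _ in ball x R, ν (ball x R) ^ s ∂ν := by
    intro x
    rw [setLIntegral_const, ENNReal.rpow_add_of_nonneg _ _ zero_le_one hs, ENNReal.rpow_one,
      mul_comm]
  simp_rw [ballMoment, h]
  exact lintegral_setLIntegral_ball_swap volume ν
    (f := fun x _ => ν (ball x R) ^ s)
    (((measurable_measure_ball ν R).comp measurable_fst).pow_const s) R

theorem ballMoment_le_corrIntegral (ν : Measure E) [IsFiniteMeasure ν] {s : ℝ} (hs : 0 ≤ s)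
    (R : ℝ) :
    ballMoment ν s R ≤ volume (ball (0 : E) R) * corrIntegral ν s (2 * R) := by
  rw [ballMoment_eq ν hs, corrIntegral,
    ← lintegral_const_mul _ ((measurable_measure_ball ν _).pow_const s)]
  refine lintegral_mono fun z => ?_
  calc ∫⁻ x in ball z R, ν (ball x R) ^ s ≤ ∫⁻ _ in ball z R, ν (ball z (2 * R)) ^ s := by
        refine setLIntegral_mono measurable_const fun x hx => ?_
        refine ENNReal.rpow_le_rpow (measure_mono (ball_subset_ball' ?_)) hs
        have := mem_ball.1 hx
        linarith
    _ = _ := by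
        rw [setLIntegral_const, mul_comm, Measure.addHaar_ball_center]

theorem corrIntegral_le_ballMoment (ν : Measure E) [IsFiniteMeasure ν] {s : ℝ} (hs : 0 ≤ s)
    (R : ℝ) :
    volume (ball (0 : E) R) * corrIntegral ν s R ≤ ballMoment ν s (2 * R) := by
  rw [ballMoment_eq ν hs, corrIntegral,
    ← lintegral_const_mul _ ((measurable_measure_ball ν _).pow_const s)]
  refine lintegral_mono fun z => ?_
  rcases le_or_gt R 0 with hR | hR
  · simp [ball_eq_empty.2 hR]
  calc volume (ball (0 : E) R) * ν (ball z R) ^ s = ∫⁻ _ in ball z R, ν (ball z R) ^ s := by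
        rw [setLIntegral_const, mul_comm, Measure.addHaar_ball_center volume z]
    _ ≤ ∫⁻ x in ball z R, ν (ball x (2 * R)) ^ s := by
        refine setLIntegral_mono ((measurable_measure_ball ν _).pow_const s) fun x hx => ?_
        refine ENNReal.rpow_le_rpow (measure_mono (ball_subset_ball' ?_)) hs
        have := mem_ball'.1 hx
        linarith
    _ ≤ ∫⁻ x in ball z (2 * R), ν (ball x (2 * R)) ^ s :=
        lintegral_mono_set (ball_subset_ball (by linarith))

/-- Doubling for ball moments: enlarging the radius by a factor `c` costs a constant which depends
neither on the measure and the radius nor on the exponent `s ∈ [0, 1]`. -/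
theorem exists_ballMoment_mul_le (c : ℝ) : ∃ K : ℝ≥0∞, K ≠ ∞ ∧ ∀ (ν : Measure E)
    [IsFiniteMeasure ν] (s : ℝ), 0 ≤ s → s ≤ 1 → ∀ R : ℝ, 0 < R →
      ballMoment ν s (c * R) ≤ K * ballMoment ν s R := by
  obtain ⟨t, -, ht, hcov⟩ := (isCompact_closedBall (0 : E) c).finite_cover_balls one_pos
  lift t to Finset E using ht
  refine ⟨((t.card + 1 : ℕ) : ℝ≥0∞) * t.card,
    ENNReal.mul_ne_top (by simp) (by simp), ?_⟩
  intro ν _ s hs0 hs1 R hR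
  have hsub : ∀ x : E, ball x (c * R) ⊆ ⋃ a ∈ t, ball (x + R • a) R := by
    intro x y hy
    have h1 : R⁻¹ • (y - x) ∈ closedBall (0 : E) c := by
      rw [mem_closedBall_zero_iff, norm_smul, Real.norm_of_nonneg (by positivity),
        inv_mul_le_iff₀ hR, ← dist_eq_norm]
      have := mem_ball.1 hy
      linarith
    obtain ⟨a, ha, hya⟩ := mem_iUnion₂.1 (hcov h1)
    refine mem_iUnion₂.2 ⟨a, ha, ?_⟩
    rw [mem_ball, dist_eq_norm] at hya ⊢
    have h2 : y - (x + R • a) = R • (R⁻¹ • (y - x) - a) := by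
      rw [smul_sub, smul_inv_smul₀ hR.ne']; abel
    rw [h2, norm_smul, Real.norm_of_nonneg hR.le]
    nlinarith
  have hp : 0 ≤ 1 + s := by linarith
  calc ballMoment ν s (c * R)
      ≤ ∫⁻ x, ((t.card + 1 : ℕ) : ℝ≥0∞)
          * ∑ a ∈ t, ν (ball (x + R • a) R) ^ (1 + s) := by
        refine lintegral_mono fun x => ?_
        calc ν (ball x (c * R)) ^ (1 + s)
            ≤ (∑ a ∈ t, ν (ball (x + R • a) R)) ^ (1 + s) :=
              ENNReal.rpow_le_rpow ((measure_mono (hsub x)).trans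
                (measure_biUnion_finset_le _ _)) hp
          _ ≤ _ := ENNReal.rpow_sum_le_const_mul_sum_rpow t _ (by linarith)
          _ ≤ _ := by
              rw [add_sub_cancel_left]
              gcongr
              calc (t.card : ℝ≥0∞) ^ s ≤ ((t.card + 1 : ℕ) : ℝ≥0∞) ^ s := by
                    gcongr; exact Nat.le_succ _
                _ ≤ ((t.card + 1 : ℕ) : ℝ≥0∞) ^ (1 : ℝ) :=
                    ENNReal.rpow_le_rpow_of_exponent_le (by simp) hs1
                _ = _ := ENNReal.rpow_one _
    _ = _ := by
        have hm : ∀ a : E, Measurable fun x => ν (ball (x + R • a) R) ^ (1 + s) := fun a =>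
          ((measurable_measure_ball ν R).comp (measurable_add_const _)).pow_const _
        rw [lintegral_const_mul _ (Finset.measurable_sum _ fun a _ => hm a),
          lintegral_finsetSum _ fun a _ => hm a]
        have : ∀ a : E, ∫⁻ x, ν (ball (x + R • a) R) ^ (1 + s) = ballMoment ν s R := fun a =>
          lintegral_add_right_eq_self (fun x => ν (ball x R) ^ (1 + s)) (R • a)
        simp [this, mul_assoc]

/-- Jensen's inequality on a set `B` for the power `1 + s`. -/
theorem setLIntegral_rpow_le {α : Type*} [MeasurableSpace α] (μ : Measure α) (B : Set α)
    {g : α → ℝ≥0∞} (hg : Measurable g) {s : ℝ} (hs : 0 < s) :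
    (∫⁻ y in B, g y ∂μ) ^ (1 + s) ≤ μ B ^ s * ∫⁻ y in B, g y ^ (1 + s) ∂μ := by
  have hpq : (1 + s).HolderConjugate ((1 + s) / s) := by
    rw [Real.holderConjugate_iff]
    refine ⟨by linarith, ?_⟩
    field_simp
  have h := ENNReal.lintegral_mul_le_Lp_mul_Lq (μ.restrict B) hpq hg.aemeasurable
    (g := fun _ => 1) aemeasurable_const
  simp only [Pi.mul_apply, mul_one, ENNReal.one_rpow, lintegral_const, one_mul,
    Measure.restrict_apply_univ] at h
  calc _ ≤ _ := ENNReal.rpow_le_rpow h (by linarith : (0 : ℝ) ≤ 1 + s)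
    _ = _ := by
      rw [ENNReal.mul_rpow_of_nonneg _ _ (by linarith), ← ENNReal.rpow_mul, ← ENNReal.rpow_mul,
        mul_comm]
      have h1 : 1 / (1 + s) * (1 + s) = 1 := by field_simp
      have h2 : 1 / ((1 + s) / s) * (1 + s) = s := by field_simp
      rw [h1, h2, ENNReal.rpow_one]

/-- If `τ` lives on the ball of radius `R₀`, then the ball moment of `κ ∗ τ` at a radius `ρ ≤ R₀`
is at most a correlation integral of `κ` at the coarse scale times the ball moment of `τ` at the
fine scale. The mass `(κ ∗ τ)(B(x, ρ))` is the `κ`-integral of `τ(B(x - y, ρ))` over the points `y`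
within `2R₀` of `x` only, so Jensen's inequality gains the factor `κ(B(x, 2R₀))^s`. -/
theorem ballMoment_conv_le (κ τ : Measure E) [IsFiniteMeasure κ] [IsFiniteMeasure τ] {s : ℝ}
    (hs : 0 < s) {R₀ ρ : ℝ} (hτ : τ (ball 0 R₀)ᶜ = 0) (hρ : ρ ≤ R₀) :
    ballMoment (κ.conv τ) s ρ ≤ corrIntegral κ s (4 * R₀) * ballMoment τ s ρ := by
  have hmτ : Measurable fun x => τ (ball x ρ) := measurable_measure_ball τ ρ
  have hmκ : Measurable fun x => κ (ball x (2 * R₀)) := measurable_measure_ball κ _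
  have h1 : ∀ x, (κ.conv τ) (ball x ρ) = ∫⁻ y in ball x (2 * R₀), τ (ball (x - y) ρ) ∂κ := by
    intro x
    rw [← lintegral_indicator_one measurableSet_ball,
      Measure.lintegral_conv (measurable_one.indicator measurableSet_ball)]
    have h2 : ∀ y, ∫⁻ z, (ball x ρ).indicator 1 (y + z) ∂τ = τ (ball (x - y) ρ) := by
      intro y
      rw [← lintegral_indicator_one measurableSet_ball]
      refine lintegral_congr fun z => ?_
      have : y + z ∈ ball x ρ ↔ z ∈ ball (x - y) ρ := by
        simp only [mem_ball, dist_eq_norm]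
        rw [show y + z - x = z - (x - y) by abel]
      by_cases hz : z ∈ ball (x - y) ρ
      · rw [indicator_of_mem (this.2 hz), indicator_of_mem hz]; rfl
      · rw [indicator_of_notMem (mt this.1 hz), indicator_of_notMem hz]
    simp_rw [h2]
    rw [← lintegral_indicator measurableSet_ball]
    refine lintegral_congr fun y => ?_
    by_cases hy : y ∈ ball x (2 * R₀)
    · rw [indicator_of_mem hy]
    · rw [indicator_of_notMem hy]
      refine measure_mono_null (fun z hz => ?_) hτ
      rw [mem_compl_iff]
      refine fun hz0 => hy ?_
      rw [mem_ball, dist_eq_norm] at hz hz0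
      rw [mem_ball', dist_eq_norm]
      calc ‖x - y‖ = ‖(z - 0) - (z - (x - y))‖ := by congr 1; abel
        _ ≤ ‖z - 0‖ + ‖z - (x - y)‖ := norm_sub_le _ _
        _ < 2 * R₀ := by linarith
  calc ballMoment (κ.conv τ) s ρ
      ≤ ∫⁻ x, ∫⁻ y in ball x (2 * R₀),
          κ (ball x (2 * R₀)) ^ s * τ (ball (x - y) ρ) ^ (1 + s) ∂κ := by
        refine lintegral_mono fun x => ?_
        have hm : Measurable fun y => τ (ball (x - y) ρ) :=
          hmτ.comp (measurable_const.sub measurable_id)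
        simp only [h1]
        rw [lintegral_const_mul _ (hm.pow_const _)]
        exact setLIntegral_rpow_le κ _ hm hs
    _ = ∫⁻ y, ∫⁻ x in ball y (2 * R₀),
          κ (ball x (2 * R₀)) ^ s * τ (ball (x - y) ρ) ^ (1 + s) ∂volume ∂κ := by
        refine lintegral_setLIntegral_ball_swap volume κ (f := fun x y =>
          κ (ball x (2 * R₀)) ^ s * τ (ball (x - y) ρ) ^ (1 + s)) ?_ _
        exact ((hmκ.comp measurable_fst).pow_const s).mul
          ((hmτ.comp (measurable_fst.sub measurable_snd)).pow_const _)
    _ ≤ ∫⁻ y, κ (ball y (4 * R₀)) ^ s * ballMoment τ s ρ ∂κ := by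
        refine lintegral_mono fun y => ?_
        have hm : Measurable fun x => τ (ball (x - y) ρ) := hmτ.comp (measurable_sub_const y)
        calc ∫⁻ x in ball y (2 * R₀), κ (ball x (2 * R₀)) ^ s * τ (ball (x - y) ρ) ^ (1 + s)
            ≤ ∫⁻ x in ball y (2 * R₀), κ (ball y (4 * R₀)) ^ s * τ (ball (x - y) ρ) ^ (1 + s) := by
              refine setLIntegral_mono ((hm.pow_const _).const_mul _) fun x hx => ?_
              gcongr
              refine ball_subset_ball' ?_
              have := mem_ball.1 hx
              linarith
          _ ≤ ∫⁻ x, κ (ball y (4 * R₀)) ^ s * τ (ball (x - y) ρ) ^ (1 + s) :=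
              setLIntegral_le_lintegral _ _
          _ = _ := by
              rw [lintegral_const_mul _ (hm.pow_const _)]
              congr 1
              exact lintegral_sub_right_eq_self (fun x => τ (ball x ρ) ^ (1 + s)) y
    _ = _ := by
        rw [lintegral_mul_const _ ((measurable_measure_ball κ _).pow_const s)]
        rfl

/-- Convolving with a probability measure on the ball of radius `R₀` does not decrease the
correlation integral, up to a change of the radius by `2 * R₀`. -/
theorem corrIntegral_le_conv (κ τ : Measure E) [IsFiniteMeasure κ] [IsProbabilityMeasure τ] {s : ℝ}
    (hs : 0 ≤ s) {R₀ : ℝ} (hτ : τ (ball 0 R₀)ᶜ = 0) (R : ℝ) :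
    corrIntegral κ s R ≤ corrIntegral (κ.conv τ) s (R + 2 * R₀) := by
  have hae : ∀ᵐ z ∂τ, z ∈ ball (0 : E) R₀ := hτ
  have hball : ∀ (x : E) (z : E), z ∈ ball (0 : E) R₀ →
      κ (ball x R) ≤ (κ.conv τ) (ball (x + z) (R + 2 * R₀)) := by
    intro x z hz
    rw [← lintegral_indicator_one (measurableSet_ball (x := x + z)),
      Measure.lintegral_conv (measurable_one.indicator measurableSet_ball),
      ← lintegral_indicator_one measurableSet_ball]
    refine lintegral_mono fun y => ?_
    by_cases hy : y ∈ ball x R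
    · rw [indicator_of_mem hy, Pi.one_apply]
      have : ∫⁻ _ : E, 1 ∂τ = 1 := by simp
      rw [← this]
      refine lintegral_mono_ae ?_
      filter_upwards [hae] with w hw
      rw [indicator_of_mem, Pi.one_apply]
      rw [mem_ball, dist_eq_norm] at *
      calc ‖y + w - (x + z)‖ = ‖(y - x) + ((w - 0) - (z - 0))‖ := by congr 1; abel
        _ ≤ ‖y - x‖ + (‖w - 0‖ + ‖z - 0‖) :=
            (norm_add_le _ _).trans (by gcongr; exact norm_sub_le _ _)
        _ < R + 2 * R₀ := by linarith
    · simp [indicator_of_notMem hy]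
  have hm := (measurable_measure_ball (κ.conv τ) (R + 2 * R₀)).pow_const s
  rw [corrIntegral, corrIntegral, Measure.lintegral_conv hm]
  refine lintegral_mono fun x => ?_
  have : ∫⁻ _ : E, κ (ball x R) ^ s ∂τ = κ (ball x R) ^ s := by simp
  rw [← this]
  refine lintegral_mono_ae ?_
  filter_upwards [hae] with z hz
  exact ENNReal.rpow_le_rpow (hball x z hz) hs

/-- Ball moments scale under a similarity of ratio `c` like Lebesgue measure. -/
theorem ballMoment_map_similarity (ν : Measure E) (S : E →ₗ[ℝ] E) {c : ℝ} (hc : 0 < c)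
    (hS : ∀ x, ‖S x‖ = c * ‖x‖) (s R : ℝ) :
    ballMoment (ν.map S) s (c * R)
      = ENNReal.ofReal (c ^ Module.finrank ℝ E) * ballMoment ν s R := by
  let L₀ : E →ₗᵢ[ℝ] E := ⟨c⁻¹ • S, fun x => by
    rw [LinearMap.smul_apply, norm_smul, hS, norm_inv, Real.norm_of_nonneg hc.le,
      inv_mul_cancel_left₀ hc.ne']⟩
  let L : E ≃ₗᵢ[ℝ] E := L₀.toLinearIsometryEquiv rfl
  have hL : ∀ x, S x = c • L x := fun x => by
    change S x = c • (c⁻¹ • S x)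
    rw [smul_inv_smul₀ hc.ne']
  have hball : ∀ x, (ν.map S) (ball (S x) (c * R)) = ν (ball x R) := by
    intro x
    rw [Measure.map_apply (LinearMap.continuous_of_finiteDimensional S).measurable
      measurableSet_ball]
    congr 1
    ext y
    rw [mem_preimage, mem_ball, mem_ball, dist_eq_norm, dist_eq_norm, ← map_sub, hS,
      mul_lt_mul_iff_right₀ hc]
  set g : E → ℝ≥0∞ := fun x => (ν.map S) (ball x (c * R)) ^ (1 + s) with hg
  have h1 : ballMoment ν s R = ∫⁻ x, g (c • L x) := by
    refine lintegral_congr fun x => ?_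
    simp only [hg]
    rw [← hL, hball]
  have h2 : ∫⁻ x, g (c • L x) = ∫⁻ x, g (c • x) :=
    (L.measurePreserving.lintegral_comp_emb L.toHomeomorph.measurableEmbedding
      (fun x => g (c • x)))
  have h3 : ∫⁻ x, g (c • x) = ENNReal.ofReal (|(c ^ Module.finrank ℝ E)⁻¹|) * ∫⁻ x, g x := by
    rw [← smul_eq_mul, ← lintegral_smul_measure, ← Measure.map_addHaar_smul volume hc.ne']
    exact ((Homeomorph.smulOfNeZero c hc.ne').measurableEmbedding.lintegral_map g).symm
  rw [h1, h2, h3, ← mul_assoc, ← ENNReal.ofReal_mul (by positivity),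
    abs_of_pos (by positivity), mul_inv_cancel₀ (by positivity), ENNReal.ofReal_one, one_mul]
  rfl

/-! ### Submultiplicativity for self-similar measures -/

/-- A solution of `ν = κ ∗ Tν` is, at every level `n`, the convolution of `Tⁿν` with some
probability measure. -/
theorem exists_eq_conv_map_pow {ν κ : Measure E} [IsProbabilityMeasure ν] [IsProbabilityMeasure κ]
    {T : E →ₗ[ℝ] E} (h : ν = κ.conv (ν.map T)) (n : ℕ) :
    ∃ κ' : Measure E, IsProbabilityMeasure κ' ∧ ν = κ'.conv (ν.map (T ^ n : E →ₗ[ℝ] E)) := by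
  have hm : ∀ S : E →ₗ[ℝ] E, Measurable S := fun S =>
    (LinearMap.continuous_of_finiteDimensional S).measurable
  have hprob : ∀ (μ : Measure E) [IsProbabilityMeasure μ] (S : E →ₗ[ℝ] E),
      IsProbabilityMeasure (μ.map S) := fun μ _ S =>
    Measure.isProbabilityMeasure_map (hm S).aemeasurable
  induction n with
  | zero =>
    refine ⟨Measure.dirac 0, inferInstance, ?_⟩
    have : ν.map ((T ^ 0 : E →ₗ[ℝ] E) : E → E) = ν := by
      rw [pow_zero]; exact Measure.map_id
    rw [this, Measure.dirac_zero_conv]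
  | succ n ih =>
    obtain ⟨κ', hκ', hn⟩ := ih
    have := hprob κ (T ^ n)
    refine ⟨κ'.conv (κ.map (T ^ n : E →ₗ[ℝ] E)), inferInstance, ?_⟩
    have h1 : ν.map (T ^ n : E →ₗ[ℝ] E)
        = (κ.map (T ^ n : E →ₗ[ℝ] E)).conv (ν.map (T ^ (n + 1) : E →ₗ[ℝ] E)) := by
      conv_lhs => rw [h]
      have h2 := Measure.map_conv_addMonoidHom (μ := κ) (ν := ν.map T)
        (T ^ n : E →ₗ[ℝ] E).toAddMonoidHom (hm (T ^ n))
      refine h2.trans ?_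
      congr 1
      exact Measure.map_map (hm (T ^ n)) (hm T)
    rw [Measure.conv_assoc, ← h1]
    exact hn

/-- A self-similar measure whose digit law `κ` lives on the ball of radius `A` is boundedly
supported. With `F R` the mass of the ball of radius `R`,
self-similarity gives `F R ≥ F ((R - A) / r)`, and the iterates of `R ↦ (R - A) / r` increase to
infinity as soon as `R > A / (1 - r)`. -/
theorem exists_measure_compl_ball_eq_zero {ν κ : Measure E} [IsProbabilityMeasure ν]
    [IsProbabilityMeasure κ] {T : E →ₗ[ℝ] E} {r : ℝ} (hr0 : 0 < r) (hr1 : r < 1)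
    (hT : ∀ x, ‖T x‖ = r * ‖x‖) (h : ν = κ.conv (ν.map T)) {A : ℝ}
    (hA : κ (closedBall 0 A)ᶜ = 0) : ∃ M : ℝ, 1 ≤ M ∧ ν (ball 0 M)ᶜ = 0 := by
  have hm : Measurable T := (LinearMap.continuous_of_finiteDimensional T).measurable
  have hae : ∀ᵐ y ∂κ, y ∈ closedBall (0 : E) A := hA
  have hA0 : 0 ≤ A := by
    obtain ⟨y, hy⟩ := hae.exists
    exact (norm_nonneg y).trans (mem_closedBall_zero_iff.1 hy)
  have hstep : ∀ R : ℝ, ν (ball 0 ((R - A) / r)) ≤ ν (ball 0 R) := by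
    intro R
    conv_rhs => rw [h]
    rw [← lintegral_indicator_one measurableSet_ball,
      ← lintegral_indicator_one measurableSet_ball,
      Measure.lintegral_conv (measurable_one.indicator measurableSet_ball)]
    set c := ∫⁻ x, (ball (0 : E) ((R - A) / r)).indicator 1 x ∂ν
    have : ∫⁻ _ : E, c ∂κ = c := by simp
    rw [← this]
    refine lintegral_mono_ae ?_
    filter_upwards [hae] with y hy
    have hmi : Measurable fun z : E => (ball (0 : E) R).indicator (1 : E → ℝ≥0∞) (y + z) :=
      (measurable_one.indicator measurableSet_ball).comp (measurable_const_add y)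
    rw [lintegral_map hmi hm]
    refine lintegral_mono fun z => ?_
    by_cases hz : z ∈ ball (0 : E) ((R - A) / r)
    · rw [indicator_of_mem hz, indicator_of_mem]
      · simp
      rw [mem_ball_zero_iff] at *
      rw [mem_closedBall_zero_iff] at hy
      rw [lt_div_iff₀ hr0] at hz
      calc ‖y + T z‖ ≤ ‖y‖ + r * ‖z‖ := (norm_add_le _ _).trans (by rw [hT])
        _ < R := by linarith
    · simp [indicator_of_notMem hz]
  set B := A / (1 - r) with hB
  have hB0 : 0 ≤ B := div_nonneg hA0 (by linarith)
  have hBr : B - A = B * r := by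
    have h1r : (1 - r) ≠ 0 := by linarith
    rw [hB]; field_simp; ring
  have hiter : ∀ k : ℕ, ν (ball 0 (B + (r⁻¹) ^ k)) ≤ ν (ball 0 (B + 1)) := by
    intro k
    induction k with
    | zero => simp
    | succ k ih =>
      refine le_trans ?_ ih
      have heq : B + r⁻¹ ^ (k + 1) = (B + r⁻¹ ^ k - A) / r := by
        rw [add_sub_right_comm, hBr, pow_succ]
        field_simp
      rw [heq]
      exact hstep _
  have hlim : Tendsto (fun k : ℕ => ν (ball 0 (B + (r⁻¹) ^ k))) atTop (𝓝 1) := by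
    have hone : 1 < r⁻¹ := (one_lt_inv₀ hr0).2 hr1
    have hmono : Monotone fun k : ℕ => ball (0 : E) (B + (r⁻¹) ^ k) := fun i j hij =>
      ball_subset_ball (by gcongr; exact hone.le)
    have := tendsto_measure_iUnion_atTop (μ := ν) hmono
    have huniv : (⋃ k : ℕ, ball (0 : E) (B + (r⁻¹) ^ k)) = univ := by
      refine eq_univ_of_forall fun x => ?_
      obtain ⟨k, hk⟩ := pow_unbounded_of_one_lt ‖x‖ hone
      exact mem_iUnion.2 ⟨k, by rw [mem_ball_zero_iff]; linarith⟩
    rwa [huniv, measure_univ] at this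
  refine ⟨B + 1, by linarith, ?_⟩
  rw [prob_compl_eq_zero_iff measurableSet_ball]
  exact le_antisymm prob_le_one (le_of_tendsto' hlim hiter)

/-- Submultiplicativity of the ball moments of a self-similar measure along the scales `rⁿ`, with a
constant that is uniform in `s ∈ (0, 1]`. -/
theorem exists_ballMoment_pow_add_le {ν κ : Measure E} [IsProbabilityMeasure ν]
    [IsProbabilityMeasure κ] {T : E →ₗ[ℝ] E} {r : ℝ} (hr0 : 0 < r) (hr1 : r < 1)
    (hT : ∀ x, ‖T x‖ = r * ‖x‖) (h : ν = κ.conv (ν.map T)) {A : ℝ}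
    (hA : κ (closedBall 0 A)ᶜ = 0) : ∃ C : ℝ≥0∞, C ≠ ∞ ∧ ∀ s : ℝ, 0 < s → s ≤ 1 → ∀ m n : ℕ,
      ballMoment ν s (r ^ (m + n)) ≤ C * ballMoment ν s (r ^ m) * ballMoment ν s (r ^ n) := by
  obtain ⟨M, hM1, hM⟩ := exists_measure_compl_ball_eq_zero hr0 hr1 hT h hA
  obtain ⟨K, hK, hdouble⟩ := exists_ballMoment_mul_le (E := E) (12 * M)
  have hV0 : volume (ball (0 : E) (6 * M)) ≠ 0 := (measure_ball_pos _ _ (by linarith)).ne'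
  have hVt : volume (ball (0 : E) (6 * M)) ≠ ∞ := measure_ball_lt_top.ne
  refine ⟨K / volume (ball (0 : E) (6 * M)), ENNReal.div_ne_top hK hV0, fun s hs0 hs1 m n => ?_⟩
  obtain ⟨κ', hκ', hm⟩ := exists_eq_conv_map_pow h m
  have hTm : ∀ x, ‖(T ^ m) x‖ = r ^ m * ‖x‖ := by
    clear hm
    intro x
    induction m generalizing x with
    | zero => simp
    | succ m ih => rw [pow_succ, Module.End.mul_apply, ih, hT]; ring
  have hrm : 0 < r ^ m := pow_pos hr0 m
  have hmeas : Measurable (T ^ m : E →ₗ[ℝ] E) :=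
    (LinearMap.continuous_of_finiteDimensional _).measurable
  set τ := ν.map (T ^ m : E →ₗ[ℝ] E) with hτdef
  have : IsProbabilityMeasure τ := Measure.isProbabilityMeasure_map hmeas.aemeasurable
  have hτ : τ (ball 0 (r ^ m * M))ᶜ = 0 := by
    rw [hτdef, Measure.map_apply hmeas measurableSet_ball.compl]
    refine measure_mono_null (fun x hx => ?_) hM
    simpa [hTm, hrm] using hx
  set d := Module.finrank ℝ E
  have hscale : volume (ball (0 : E) (6 * (r ^ m * M)))
      = ENNReal.ofReal ((r ^ m) ^ d) * volume (ball (0 : E) (6 * M)) := by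
    rw [← Measure.addHaar_ball_mul_of_pos volume (0 : E) hrm]
    congr 2; ring
  have hcorr : ENNReal.ofReal ((r ^ m) ^ d) * corrIntegral κ' s (4 * (r ^ m * M))
      ≤ K / volume (ball (0 : E) (6 * M)) * ballMoment ν s (r ^ m) := by
    have h1 : corrIntegral κ' s (4 * (r ^ m * M)) ≤ corrIntegral ν s (6 * (r ^ m * M)) := by
      have := corrIntegral_le_conv κ' τ hs0.le hτ (4 * (r ^ m * M))
      rw [← hm] at this
      convert this using 2
      ring
    have h2 := corrIntegral_le_ballMoment ν hs0.le (6 * (r ^ m * M))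
    have h3 := hdouble ν s hs0.le hs1 (r ^ m) hrm
    rw [show 2 * (6 * (r ^ m * M)) = 12 * M * r ^ m by ring, hscale] at h2
    rw [ENNReal.mul_comm_div, ← mul_div_assoc]
    refine (ENNReal.le_div_iff_mul_le (Or.inl hV0) (Or.inl hVt)).2 ?_
    calc _ ≤ ENNReal.ofReal ((r ^ m) ^ d) * corrIntegral ν s (6 * (r ^ m * M))
          * volume (ball (0 : E) (6 * M)) := by gcongr
      _ = ENNReal.ofReal ((r ^ m) ^ d) * volume (ball (0 : E) (6 * M))
          * corrIntegral ν s (6 * (r ^ m * M)) := by ring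
      _ ≤ _ := h2.trans h3
  calc ballMoment ν s (r ^ (m + n))
      ≤ corrIntegral κ' s (4 * (r ^ m * M)) * ballMoment τ s (r ^ (m + n)) := by
        conv_lhs => rw [hm]
        refine ballMoment_conv_le κ' τ hs0 hτ ?_
        rw [pow_add]
        gcongr
        exact (pow_le_one₀ hr0.le hr1.le).trans hM1
    _ = (ENNReal.ofReal ((r ^ m) ^ d) * corrIntegral κ' s (4 * (r ^ m * M)))
          * ballMoment ν s (r ^ n) := by
        rw [pow_add, hτdef, ballMoment_map_similarity ν (T ^ m) hrm hTm]
        ring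
    _ ≤ _ := by gcongr

/-! ### Heavy balls of a measure of full dimension -/

theorem card_mul_le_one_of_isSeparated {X : Type*} [PseudoMetricSpace X] [MeasurableSpace X]
    [OpensMeasurableSpace X] {ν : Measure X} [IsProbabilityMeasure ν] {t : ℝ} (ρ : NNReal)
    (F : Finset X) (hF : ∀ x ∈ F, ENNReal.ofReal t < ν (ball x ρ))
    (hsep : IsSeparated (2 * ρ : NNReal) (F : Set X)) :
    F.card * t ≤ 1 := by
  have hdisj : (F : Set X).PairwiseDisjoint fun x => ball x (ρ : ℝ) := by
    intro x hx y hy hxy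
    refine ball_disjoint_ball ?_
    have : ((2 * ρ : NNReal) : ℝ≥0∞) < edist x y := hsep hx hy hxy
    rw [edist_dist, ENNReal.lt_ofReal_iff_toReal_lt ENNReal.coe_ne_top] at this
    simp at this
    linarith
  have h1 : ∑ x ∈ F, ν (ball x ρ) ≤ 1 := by
    rw [← measure_biUnion_finset hdisj fun _ _ => measurableSet_ball]
    exact prob_le_one
  have h2 : (F.card : ℝ≥0∞) * ENNReal.ofReal t ≤ 1 := by
    refine le_trans ?_ h1
    rw [← nsmul_eq_mul]
    exact Finset.card_nsmul_le_sum _ _ _ fun x hx => (hF x hx).le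
  rw [← ENNReal.ofReal_natCast, ← ENNReal.ofReal_mul (by positivity), ENNReal.ofReal_le_one] at h2
  exact h2

/-- The points whose `ρ`-ball has mass more than `t` are covered by at most `1 / t` balls of radius
`2ρ`: the `ρ`-balls about a maximal `2ρ`-separated set of such points are disjoint. -/
theorem exists_finset_cover_of_lt_measure_ball {X : Type*} [PseudoMetricSpace X]
    [MeasurableSpace X] [OpensMeasurableSpace X] (ν : Measure X) [IsProbabilityMeasure ν] {t : ℝ}
    (ht : 0 < t) (ρ : NNReal) : ∃ F : Finset X, F.card * t ≤ 1 ∧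
      {x | ENNReal.ofReal t < ν (ball x ρ)} ⊆ ⋃ x ∈ F, closedBall x (2 * ρ) := by
  set A := {x | ENNReal.ofReal t < ν (ball x ρ)} with hA
  have hpack : packingNumber (2 * ρ) A ≠ ⊤ := by
    refine ne_top_of_le_ne_top (ENat.natCast_ne_top ⌊1 / t⌋₊) ?_
    refine iSup_le fun C => iSup₂_le fun hCA hC => ?_
    by_contra! hlt
    obtain ⟨D, hDC, hD⟩ := exists_subset_encard_eq (Order.add_one_le_of_lt hlt)
    have hfin : D.Finite := by
      refine encard_ne_top_iff.1 ?_
      rw [hD]; exact ENat.natCast_ne_top (⌊1 / t⌋₊ + 1)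
    lift D to Finset X using hfin
    have h1 := card_mul_le_one_of_isSeparated ρ D (fun x hx => hCA (hDC hx)) (hC.subset hDC)
    have h2 : D.card = ⌊1 / t⌋₊ + 1 := by
      rw [encard_coe_eq_coe_finsetCard] at hD
      exact_mod_cast hD
    rw [h2, ← le_div_iff₀ ht] at h1
    have h3 := Nat.lt_floor_add_one (1 / t)
    push_cast at h1
    linarith
  have hcover := isCover_maximalSeparatedSet hpack
  have hfin : (maximalSeparatedSet (2 * ρ) A).Finite := by
    refine encard_ne_top_iff.1 ?_
    rwa [encard_maximalSeparatedSet hpack]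
  have hsub : maximalSeparatedSet (2 * ρ) A ⊆ A := maximalSeparatedSet_subset
  have hsep : IsSeparated (2 * ρ : NNReal) (maximalSeparatedSet (2 * ρ) A) :=
    isSeparated_maximalSeparatedSet
  lift maximalSeparatedSet (2 * ρ) A to Finset X using hfin with F
  refine ⟨F, card_mul_le_one_of_isSeparated ρ F (fun x hx => hsub hx) hsep, fun x hx => ?_⟩
  obtain ⟨y, hy, hxy⟩ := hcover hx
  refine mem_iUnion₂.2 ⟨y, hy, ?_⟩
  rw [mem_closedBall]
  have : edist x y ≤ (2 * ρ : NNReal) := hxy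
  rw [edist_le_coe] at this
  exact_mod_cast this

/-- If the sets of positive `ν`-measure have dimension at least `D`, then for `u < D` the points
with `ν(B(x, c rⁿ)) > r^(n u)` have mass tending to `0`: the limsup of these sets has
dimension less than `D`, so it is null. -/
theorem tendsto_measure_lt_measure_ball (ν : Measure E) [IsProbabilityMeasure ν] {D u : ℝ}
    (hu0 : 0 ≤ u) (huD : u < D)
    (hdim : ∀ A : Set E, MeasurableSet A → 0 < ν A → ENNReal.ofReal D ≤ dimH A)
    {r : ℝ} (hr0 : 0 < r) (hr1 : r < 1) {c : ℝ} (hc : 0 < c) :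
    Tendsto (fun n : ℕ => ν {x | ENNReal.ofReal ((r ^ n) ^ u) < ν (ball x (c * r ^ n))}) atTop
      (𝓝 0) := by
  set A : ℕ → Set E := fun n => {x | ENNReal.ofReal ((r ^ n) ^ u) < ν (ball x (c * r ^ n))}
    with hA
  have hAm : ∀ n, MeasurableSet (A n) := fun n =>
    measurableSet_lt measurable_const (measurable_measure_ball ν _)
  set B : ℕ → Set E := fun n => ⋃ k, A (k + n) with hB
  have hBm : ∀ n, MeasurableSet (B n) := fun n => MeasurableSet.iUnion fun k => hAm _
  have hBanti : Antitone B := by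
    intro i j hij x hx
    obtain ⟨k, hk⟩ := mem_iUnion.1 hx
    refine mem_iUnion.2 ⟨k + (j - i), ?_⟩
    rwa [add_assoc, Nat.sub_add_cancel hij]
  have hnull : ν (⋂ n, B n) = 0 := by
    by_contra hpos
    obtain ⟨v, huv, hvD⟩ := exists_between huD
    have hv0 : 0 ≤ v := hu0.trans huv.le
    have hdimle : dimH (⋂ n, B n) ≤ ENNReal.ofReal v := by
      have hcov : ∀ k : ℕ, ∃ F : Finset E, F.card * (r ^ k) ^ u ≤ 1 ∧
          A k ⊆ ⋃ x ∈ F, closedBall x (2 * (c * r ^ k)) := fun k =>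
        exists_finset_cover_of_lt_measure_ball ν (by positivity) ⟨c * r ^ k, by positivity⟩
      choose F hFcard hFcov using hcov
      set S : ℝ≥0∞ := ∑' k : ℕ, ENNReal.ofReal ((4 * c) ^ v * (r ^ (v - u)) ^ k) with hS
      have hSfin : S ≠ ∞ := by
        rw [hS, ← ENNReal.ofReal_tsum_of_nonneg (fun k => by positivity)]
        · exact ENNReal.ofReal_ne_top
        · refine (summable_geometric_of_lt_one (by positivity) ?_).mul_left _
          exact Real.rpow_lt_one hr0.le hr1 (by linarith)
      have hdiam : ∀ (x : E) (k : ℕ),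
          ediam (closedBall x (2 * (c * r ^ k))) ≤ ENNReal.ofReal (4 * c * r ^ k) := by
        intro x k
        rw [show 4 * c * r ^ k = 2 * (2 * (c * r ^ k)) by ring]
        refine (ediam_le_of_forall_dist_le fun y hy z hz => ?_)
        have := mem_closedBall.1 hy
        have := mem_closedBall'.1 hz
        linarith [dist_triangle y x z]
      have hH : Measure.hausdorffMeasure v (⋂ n, B n) ≤ S := by
        refine (Measure.hausdorffMeasure_le_liminf_tsum (l := atTop) (ι := fun n : ℕ =>
          (Σ k : ℕ, F (k + n))) v _ (fun n : ℕ => ENNReal.ofReal (4 * c * r ^ n)) ?_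
          (fun n i => closedBall (i.2 : E) (2 * (c * r ^ (i.1 + n)))) ?_ ?_).trans ?_
        · have : Tendsto (fun n : ℕ => 4 * c * r ^ n) atTop (𝓝 (4 * c * 0)) :=
            (tendsto_pow_atTop_nhds_zero_of_lt_one hr0.le hr1).const_mul _
          simpa using ENNReal.tendsto_ofReal this
        · refine Eventually.of_forall fun n i => (hdiam _ _).trans ?_
          refine ENNReal.ofReal_le_ofReal ?_
          have : r ^ (i.1 + n) ≤ r ^ n := pow_le_pow_of_le_one hr0.le hr1.le (by omega)
          gcongr
        · refine Eventually.of_forall fun n x hx => ?_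
          obtain ⟨k, hk⟩ := mem_iUnion.1 (mem_iInter.1 hx n)
          obtain ⟨y, hy, hxy⟩ := mem_iUnion₂.1 (hFcov _ hk)
          exact mem_iUnion.2 ⟨⟨k, ⟨y, hy⟩⟩, hxy⟩
        · refine liminf_le_of_le (by isBoundedDefault) fun b hb => ?_
          obtain ⟨n, hn⟩ := hb.exists
          refine hn.trans ?_
          rw [ENNReal.tsum_sigma']
          calc _ ≤ ∑' k : ℕ, ENNReal.ofReal ((4 * c) ^ v * (r ^ (v - u)) ^ (k + n)) := by
                refine ENNReal.tsum_le_tsum fun k => ?_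
                set j := k + n
                rw [tsum_fintype]
                calc _ ≤ ∑ _ : F j, ENNReal.ofReal ((4 * c * r ^ j) ^ v) := by
                      refine Finset.sum_le_sum fun i _ => ?_
                      rw [← ENNReal.ofReal_rpow_of_nonneg (by positivity) hv0]
                      exact ENNReal.rpow_le_rpow (hdiam _ _) hv0
                  _ = ENNReal.ofReal ((F j).card * (4 * c * r ^ j) ^ v) := by
                      simp [ENNReal.ofReal_mul]
                  _ ≤ _ := by
                      refine ENNReal.ofReal_le_ofReal ?_
                      have h1 : (r ^ (v - u)) ^ j = (r ^ j) ^ v / (r ^ j) ^ u := by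
                        rw [← Real.rpow_natCast, ← Real.rpow_mul hr0.le, mul_comm,
                          Real.rpow_mul hr0.le, Real.rpow_natCast, Real.rpow_sub (by positivity)]
                      rw [h1, Real.mul_rpow (by positivity) (by positivity), mul_div_assoc',
                        le_div_iff₀ (by positivity)]
                      calc _ = (F j).card * (r ^ j) ^ u * ((4 * c) ^ v * (r ^ j) ^ v) := by ring
                        _ ≤ _ := mul_le_of_le_one_left (by positivity) (hFcard j)
            _ ≤ S := ENNReal.tsum_comp_le_tsum_of_injective (add_left_injective n) _
      have := dimH_le_of_hausdorffMeasure_ne_top (d := ⟨v, hv0⟩) (ne_top_of_le_ne_top hSfin hH)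
      rwa [ENNReal.ofReal, Real.toNNReal_of_nonneg hv0]
    have h1 := (hdim _ (MeasurableSet.iInter hBm) (pos_iff_ne_zero.2 hpos)).trans hdimle
    rw [ENNReal.ofReal_le_ofReal_iff hv0] at h1
    linarith
  have hlim := tendsto_measure_iInter_atTop (μ := ν) (fun n => (hBm n).nullMeasurableSet) hBanti
    ⟨0, measure_ne_top _ _⟩
  rw [hnull] at hlim
  refine tendsto_of_tendsto_of_tendsto_of_le_of_le tendsto_const_nhds hlim (fun _ => zero_le)
    fun n => measure_mono fun x hx => mem_iUnion.2 ⟨0, by rwa [zero_add]⟩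

/-! ### The large deviation estimate -/

theorem corrIntegral_le_add (ν : Measure E) [IsProbabilityMeasure ν] {s t : ℝ} (hs : 0 ≤ s)
    (ht : 0 ≤ t) (R : ℝ) :
    corrIntegral ν s R ≤ ENNReal.ofReal (t ^ s) + ν {x | ENNReal.ofReal t < ν (ball x R)} := by
  have hm : MeasurableSet {x | ENNReal.ofReal t < ν (ball x R)} :=
    measurableSet_lt measurable_const (measurable_measure_ball ν _)
  calc corrIntegral ν s R
      ≤ ∫⁻ x, ENNReal.ofReal (t ^ s)
          + {x | ENNReal.ofReal t < ν (ball x R)}.indicator 1 x ∂ν := by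
        refine lintegral_mono fun x => ?_
        by_cases hx : x ∈ {x | ENNReal.ofReal t < ν (ball x R)}
        · rw [indicator_of_mem hx]
          exact (ENNReal.rpow_le_one prob_le_one hs).trans le_add_self
        · rw [indicator_of_notMem hx, add_zero, ← ENNReal.ofReal_rpow_of_nonneg ht hs]
          exact ENNReal.rpow_le_rpow (not_lt.1 hx) hs
    _ = _ := by
        rw [lintegral_add_left measurable_const, lintegral_const, measure_univ, mul_one,
          lintegral_indicator_one hm]

theorem mul_measure_lt_measure_ball_le (ν : Measure E) [IsProbabilityMeasure ν] {s t : ℝ}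
    (hs : 0 ≤ s) (ht : 0 ≤ t) (R : ℝ) :
    ENNReal.ofReal (t ^ s) * ν {x | ENNReal.ofReal t < ν (ball x R)} ≤ corrIntegral ν s R := by
  refine le_trans ?_ (mul_meas_ge_le_lintegral ((measurable_measure_ball ν R).pow_const s)
    (ENNReal.ofReal (t ^ s)))
  refine mul_le_mul' le_rfl (measure_mono fun x hx => ?_)
  rw [mem_ofPred_eq, ← ENNReal.ofReal_rpow_of_nonneg ht hs]
  exact ENNReal.rpow_le_rpow (le_of_lt hx) hs

/-- The ball moments of a self-similar measure of full dimension `d` decay at a power rate that is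
close to the optimal one. By submultiplicativity one good scale `ρ` suffices: there, for some `u₂`
between `u₁` and `d`, the bound `ν(B(x, 2ρ)) ≤ ρ^u₂` holds up to small mass, and `s` is tied to `ρ`
by `ρ^s = θ`, where the constant `θ` is so small that `θ^(u₂ - u₁)` absorbs the submultiplicativity
constant. -/
theorem exists_ballMoment_pow_le {ν κ : Measure E} [IsProbabilityMeasure ν]
    [IsProbabilityMeasure κ] {T : E →ₗ[ℝ] E} {r : ℝ} (hr0 : 0 < r) (hr1 : r < 1)
    (hT : ∀ x, ‖T x‖ = r * ‖x‖) (h : ν = κ.conv (ν.map T)) {A : ℝ}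
    (hA : κ (closedBall 0 A)ᶜ = 0)
    (hdim : ∀ A : Set E, MeasurableSet A → 0 < ν A →
      ENNReal.ofReal (Module.finrank ℝ E) ≤ dimH A)
    {u₁ : ℝ} (hu0 : 0 ≤ u₁) (hu : u₁ < Module.finrank ℝ E) :
    ∃ ρ s : ℝ, 0 < ρ ∧ ρ < 1 ∧ 0 < s ∧ s ≤ 1 ∧ ∀ k : ℕ,
      ballMoment ν s (ρ ^ (k + 1))
        ≤ ENNReal.ofReal ((ρ ^ (k + 1)) ^ Module.finrank ℝ E * ((ρ ^ (k + 1)) ^ u₁) ^ s) := by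
  set d := Module.finrank ℝ E with hd
  obtain ⟨C₀, hC₀, hsub₀⟩ := exists_ballMoment_pow_add_le hr0 hr1 hT h hA
  -- A constant that is at least `1` can be carried along in the iteration.
  set C := max C₀ 1 with hCdef
  have hC : C ≠ ∞ := by simp [hCdef, hC₀]
  have hC1 : 1 ≤ C := le_max_right _ _
  have hsub : ∀ s : ℝ, 0 < s → s ≤ 1 → ∀ m n : ℕ,
      ballMoment ν s (r ^ (m + n)) ≤ C * ballMoment ν s (r ^ m) * ballMoment ν s (r ^ n) :=
    fun s h0 h1 m n => (hsub₀ s h0 h1 m n).trans (by gcongr; exact le_max_left _ _)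
  obtain ⟨u₂, hu12, hu2d⟩ := exists_between hu
  set ω := volume (ball (0 : E) 1) with hω
  have hωt : ω ≠ ∞ := measure_ball_lt_top.ne
  set c := (C * ω).toReal with hc
  have hcC : C * ω = ENNReal.ofReal c := (ENNReal.ofReal_toReal (ENNReal.mul_ne_top hC hωt)).symm
  have hc0 : 0 ≤ c := ENNReal.toReal_nonneg
  have ha : 0 < u₂ - u₁ := by linarith
  set θ : ℝ := (2 * c + 2)⁻¹ ^ (u₂ - u₁)⁻¹ with hθ
  have hθ0 : 0 < θ := by positivity
  have hθ1 : θ < 1 := Real.rpow_lt_one (by positivity) (inv_lt_one_of_one_lt₀ (by linarith))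
    (by positivity)
  have hθa : 2 * c * θ ^ (u₂ - u₁) ≤ 1 := by
    rw [hθ, ← Real.rpow_mul (by positivity), inv_mul_cancel₀ ha.ne', Real.rpow_one,
      ← div_eq_mul_inv, div_le_one (by positivity)]
    linarith
  have hlim := tendsto_measure_lt_measure_ball ν (hu0.trans hu12.le) hu2d hdim hr0 hr1 two_pos
  have hev1 := hlim.eventually_lt_const (ENNReal.ofReal_pos.2 (by positivity : 0 < θ ^ (d : ℝ)))
  have hev2 := (tendsto_pow_atTop_nhds_zero_of_lt_one hr0.le hr1).eventually_le_const hθ0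
  obtain ⟨N, hN1, hN2⟩ := (hev1.and hev2).exists
  set ρ := r ^ N with hρ
  have hρ0 : 0 < ρ := by positivity
  have hρ1 : ρ < 1 := hN2.trans_lt hθ1
  have hlogρ : Real.log ρ < 0 := Real.log_neg hρ0 hρ1
  set s := Real.log θ / Real.log ρ with hs
  have hs0 : 0 < s := div_pos_of_neg_of_neg (Real.log_neg hθ0 hθ1) hlogρ
  have hs1 : s ≤ 1 := by
    rw [hs, div_le_one_of_neg hlogρ]
    exact Real.log_le_log hρ0 hN2
  have hρs : ρ ^ s = θ := by
    rw [Real.rpow_def_of_pos hρ0, hs, mul_div_cancel₀ _ hlogρ.ne, Real.exp_log hθ0]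
  have hswap : ∀ u : ℝ, (ρ ^ u) ^ s = θ ^ u := fun u => by
    rw [← Real.rpow_mul hρ0.le, mul_comm, Real.rpow_mul hρ0.le, hρs]
  have hone : C * ballMoment ν s ρ ≤ ENNReal.ofReal (ρ ^ d * θ ^ u₁) := by
    have hcorr : corrIntegral ν s (2 * ρ) ≤ ENNReal.ofReal (2 * θ ^ u₂) := by
      refine (corrIntegral_le_add ν hs0.le (by positivity : 0 ≤ ρ ^ u₂) (2 * ρ)).trans ?_
      rw [hswap, two_mul (θ ^ u₂), ENNReal.ofReal_add (by positivity) (by positivity)]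
      gcongr
      refine hN1.le.trans (ENNReal.ofReal_le_ofReal ?_)
      exact Real.rpow_le_rpow_of_exponent_ge hθ0 hθ1.le hu2d.le
    have hvol : volume (ball (0 : E) ρ) = ENNReal.ofReal (ρ ^ d) * ω := by
      rw [hω, ← Measure.addHaar_ball_mul_of_pos volume (0 : E) hρ0, mul_one]
    calc C * ballMoment ν s ρ
        ≤ C * (ENNReal.ofReal (ρ ^ d) * ω * ENNReal.ofReal (2 * θ ^ u₂)) := by
          gcongr
          refine (ballMoment_le_corrIntegral ν hs0.le ρ).trans ?_
          rw [hvol]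
          gcongr
      _ = ENNReal.ofReal (ρ ^ d) * (C * ω) * ENNReal.ofReal (2 * θ ^ u₂) := by ring
      _ = ENNReal.ofReal (ρ ^ d * c * (2 * θ ^ u₂)) := by
          rw [hcC, ← ENNReal.ofReal_mul (by positivity), ← ENNReal.ofReal_mul (by positivity)]
      _ ≤ _ := by
          refine ENNReal.ofReal_le_ofReal ?_
          have : θ ^ u₂ = θ ^ (u₂ - u₁) * θ ^ u₁ := by
            rw [← Real.rpow_add hθ0, sub_add_cancel]
          rw [this]
          calc _ = ρ ^ d * θ ^ u₁ * (2 * c * θ ^ (u₂ - u₁)) := by ring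
            _ ≤ _ := mul_le_of_le_one_right (by positivity) hθa
  have hpow : ∀ k : ℕ, C * ballMoment ν s (ρ ^ (k + 1))
      ≤ ENNReal.ofReal (ρ ^ d * θ ^ u₁) ^ (k + 1) := by
    intro k
    induction k with
    | zero => simpa using hone
    | succ k ih =>
      have h1 := hsub s hs0 hs1 (N * (k + 1)) N
      rw [pow_add, pow_mul, ← hρ, ← pow_succ] at h1
      calc _ ≤ C * (C * ballMoment ν s (ρ ^ (k + 1)) * ballMoment ν s ρ) := by gcongr
        _ = (C * ballMoment ν s (ρ ^ (k + 1))) * (C * ballMoment ν s ρ) := by ring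
        _ ≤ ENNReal.ofReal (ρ ^ d * θ ^ u₁) ^ (k + 1) * ENNReal.ofReal (ρ ^ d * θ ^ u₁) := by
            gcongr
        _ = _ := (pow_succ _ _).symm
  refine ⟨ρ, s, hρ0, hρ1, hs0, hs1, fun k => ?_⟩
  calc ballMoment ν s (ρ ^ (k + 1)) ≤ C * ballMoment ν s (ρ ^ (k + 1)) :=
        le_mul_of_one_le_left (zero_le) hC1
    _ ≤ _ := hpow k
    _ = _ := by
        rw [← ENNReal.ofReal_pow (by positivity), mul_pow, ← hswap, ← pow_mul, mul_comm d, pow_mul]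
        congr 2
        rw [← Real.rpow_natCast, ← Real.rpow_mul (by positivity), ← Real.rpow_mul (by positivity),
          ← Real.rpow_mul (by positivity), ← Real.rpow_natCast, ← Real.rpow_mul (by positivity)]
        congr 1; ring

/-- The large deviation estimate: for `u < d` the points with `ν(B(x, ρᵏ)) > ρ^(k u)` have mass
exponentially small in `k`. -/
theorem exists_measure_lt_measure_ball_le {ν κ : Measure E} [IsProbabilityMeasure ν]
    [IsProbabilityMeasure κ] {T : E →ₗ[ℝ] E} {r : ℝ} (hr0 : 0 < r) (hr1 : r < 1)
    (hT : ∀ x, ‖T x‖ = r * ‖x‖) (h : ν = κ.conv (ν.map T)) {A : ℝ}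
    (hA : κ (closedBall 0 A)ᶜ = 0)
    (hdim : ∀ A : Set E, MeasurableSet A → 0 < ν A →
      ENNReal.ofReal (Module.finrank ℝ E) ≤ dimH A)
    {u : ℝ} (hu0 : 0 ≤ u) (hu : u < Module.finrank ℝ E) :
    ∃ ρ δ K : ℝ, 0 < ρ ∧ ρ < 1 ∧ 0 < δ ∧ 0 ≤ K ∧ ∀ k : ℕ,
      ν {x | ENNReal.ofReal ((ρ ^ k) ^ u) < ν (ball x (ρ ^ k))}
        ≤ ENNReal.ofReal (K * (ρ ^ k) ^ δ) := by
  obtain ⟨u₁, huu, hu1⟩ := exists_between hu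
  obtain ⟨ρ, s, hρ0, hρ1, hs0, hs1, hmom⟩ :=
    exists_ballMoment_pow_le hr0 hr1 hT h hA hdim (hu0.trans huu.le) hu1
  obtain ⟨K₀, hK₀, hdouble⟩ := exists_ballMoment_mul_le (E := E) 2
  set d := Module.finrank ℝ E with hd
  set ω := volume (ball (0 : E) 1) with hω
  have hωt : ω ≠ ∞ := measure_ball_lt_top.ne
  have hω0 : ω ≠ 0 := (measure_ball_pos _ _ one_pos).ne'
  set K := (K₀ / ω).toReal with hK
  have hKe : K₀ / ω = ENNReal.ofReal K :=
    (ENNReal.ofReal_toReal (ENNReal.div_ne_top hK₀ hω0)).symm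
  have hKn : 0 ≤ K := ENNReal.toReal_nonneg
  refine ⟨ρ, (u₁ - u) * s, max K 1, hρ0, hρ1, mul_pos (by linarith) hs0, by positivity, ?_⟩
  rintro (_ | k)
  · simp [prob_le_one]
  set R := ρ ^ (k + 1) with hR
  have hR0 : 0 < R := by positivity
  have hcorr : corrIntegral ν s R ≤ ENNReal.ofReal (K * (R ^ u₁) ^ s) := by
    have hvol : volume (ball (0 : E) R) = ENNReal.ofReal (R ^ d) * ω := by
      rw [hω, ← Measure.addHaar_ball_mul_of_pos volume (0 : E) hR0, mul_one]
    have h1 : ENNReal.ofReal (R ^ d) * (ω * corrIntegral ν s R)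
        ≤ ENNReal.ofReal (R ^ d) * (K₀ * ENNReal.ofReal ((R ^ u₁) ^ s)) := by
      rw [← mul_assoc, ← hvol]
      calc _ ≤ _ := corrIntegral_le_ballMoment ν hs0.le R
        _ ≤ _ := hdouble ν s hs0.le hs1 R hR0
        _ ≤ K₀ * ENNReal.ofReal (R ^ d * (R ^ u₁) ^ s) := by gcongr; exact hmom k
        _ = _ := by rw [ENNReal.ofReal_mul (by positivity)]; ring
    rw [ENNReal.mul_le_mul_iff_right (by positivity) ENNReal.ofReal_ne_top] at h1
    rw [ENNReal.ofReal_mul hKn, ← hKe, ENNReal.mul_comm_div, ← mul_div_assoc]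
    exact (ENNReal.le_div_iff_mul_le (Or.inl hω0) (Or.inl hωt)).2 (by rwa [mul_comm])
  have h2 := (mul_measure_lt_measure_ball_le ν hs0.le (by positivity : 0 ≤ R ^ u) R).trans hcorr
  have h3 : K * (R ^ u₁) ^ s = (R ^ u) ^ s * (K * R ^ ((u₁ - u) * s)) := by
    rw [← Real.rpow_mul hR0.le, ← Real.rpow_mul hR0.le, mul_left_comm, ← Real.rpow_add hR0]
    congr 2; ring
  rw [h3, ENNReal.ofReal_mul (by positivity),
    ENNReal.mul_le_mul_iff_right (by positivity) ENNReal.ofReal_ne_top] at h2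
  refine h2.trans (ENNReal.ofReal_le_ofReal ?_)
  gcongr
  exact le_max_left _ _

/-! ### Fourier analysis of finite measures -/

open scoped FourierTransform SchwartzMap RealInnerProductSpace

/-- Integrating a Schwartz function against a finite measure on the Fourier side: Fubini and
Fourier inversion. The characteristic function is taken at `2πξ` to match the normalization of
`𝓕`. -/
theorem integral_schwartz_eq (Λ : Measure E) [IsFiniteMeasure Λ] (f : 𝓢(E, ℂ)) :
    ∫ x, f x ∂Λ = ∫ ξ, charFun Λ ((2 * Real.pi) • ξ) * 𝓕 f ξ := by
  have h1 : ∀ x, f x = ∫ ξ, Complex.exp ((↑(2 * Real.pi * ⟪ξ, x⟫) * Complex.I)) * 𝓕 f ξ := by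
    intro x
    have h2 : 𝓕⁻ (𝓕 f) = f := FourierTransform.fourierInv_fourier_eq f
    conv_lhs => rw [← h2]
    rw [SchwartzMap.fourierInv_coe, Real.fourierInv_eq']
    rfl
  simp_rw [h1]
  rw [integral_integral_swap]
  · refine integral_congr_ae (Eventually.of_forall fun ξ => ?_)
    simp only
    rw [integral_mul_const, charFun_apply]
    congr 1
    refine integral_congr_ae (Eventually.of_forall fun x => ?_)
    simp only
    rw [inner_smul_right, real_inner_comm]
  · have hi : Integrable (fun p : E × E => 𝓕 f p.2) (Λ.prod volume) :=
      (𝓕 f).integrable.comp_snd Λ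
    refine Integrable.bdd_mul hi (c := 1) ?_ ?_
    · refine Continuous.aestronglyMeasurable ?_
      fun_prop
    · refine Eventually.of_forall fun p => ?_
      rw [Complex.norm_exp_ofReal_mul_I]

/-- Compact sets are tested with a smooth bump function, to which Plancherel's theorem and the
Cauchy-Schwarz inequality on the Fourier side apply. -/
theorem sq_measure_isCompact_le (Λ : Measure E) [IsFiniteMeasure Λ] {K U : Set E} (hK : IsCompact K)
    (hU : IsOpen U) (hKU : K ⊆ U) :
    Λ K ^ 2 ≤ (∫⁻ ξ, ‖charFun Λ ((2 * Real.pi) • ξ)‖ₑ ^ 2) * volume U := by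
  -- A smooth compactly supported `g` with `1_K ≤ g ≤ 1_U`.
  obtain ⟨g, hg, hgr, hgs, hg1⟩ := exists_contMDiff_support_eq_eq_one_iff (n := ⊤)
    (modelWithCornersSelf ℝ E) (hU.inter (isOpen_thickening (δ := 1) (E := K))) hK.isClosed
    (subset_inter hKU (self_subset_thickening one_pos K))
  have hg01 : ∀ x, 0 ≤ g x ∧ g x ≤ 1 := fun x => hgr (mem_range_self x)
  have hgc : HasCompactSupport g := by
    refine HasCompactSupport.of_support_subset_isCompact
      (isCompact_of_isClosed_isBounded (isClosed_cthickening (δ := 1) (E := K))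
        hK.isBounded.cthickening) ?_
    rw [hgs]
    exact inter_subset_right.trans (thickening_subset_cthickening _ _)
  have hgd : ContDiff ℝ ((⊤ : ℕ∞) : WithTop ℕ∞) g := hg.contDiff
  have hfc : HasCompactSupport fun x => (g x : ℂ) := hgc.comp_left Complex.ofReal_zero
  set f : 𝓢(E, ℂ) := hfc.toSchwartzMap (Complex.ofRealCLM.contDiff.comp hgd) with hf
  have hfg : ∀ x, f x = (g x : ℂ) := fun x => rfl
  have hgi : Integrable g Λ := hgd.continuous.integrable_of_hasCompactSupport hgc
  have hKle : Λ K ≤ ‖∫ x, f x ∂Λ‖ₑ := by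
    simp_rw [hfg]
    rw [integral_complex_ofReal, ← ofReal_norm, Complex.norm_real,
      Real.norm_of_nonneg (integral_nonneg fun x => (hg01 x).1),
      ofReal_integral_eq_lintegral_ofReal hgi (Eventually.of_forall fun x => (hg01 x).1),
      ← lintegral_indicator_one hK.measurableSet]
    refine lintegral_mono fun x => ?_
    by_cases hx : x ∈ K
    · rw [indicator_of_mem hx, (hg1 x).1 hx]; simp
    · rw [indicator_of_notMem hx]; exact zero_le
  have hL2 : ∫⁻ ξ, ‖𝓕 f ξ‖ₑ ^ 2 ≤ volume U := by
    have hint : ∀ h : 𝓢(E, ℂ), ∫⁻ ξ, ‖h ξ‖ₑ ^ 2 = ENNReal.ofReal (∫ ξ, ‖h ξ‖ ^ 2) := by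
      intro h
      have hm : MemLp h 2 volume := h.memLp 2
      rw [ofReal_integral_eq_lintegral_ofReal (hm.integrable_norm_pow two_ne_zero)
        (Eventually.of_forall fun x => by positivity)]
      refine lintegral_congr fun x => ?_
      rw [ENNReal.ofReal_pow (norm_nonneg _), ofReal_norm]
    rw [hint, SchwartzMap.integral_norm_sq_fourier, ← hint, ← lintegral_indicator_one
      hU.measurableSet]
    refine lintegral_mono fun x => ?_
    by_cases hx : x ∈ U
    · rw [indicator_of_mem hx, hfg, ← ofReal_norm, Complex.norm_real,
        Real.norm_of_nonneg (hg01 x).1]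
      exact pow_le_one₀ (zero_le) (ENNReal.ofReal_le_one.2 (hg01 x).2)
    · have : g x = 0 := by
        by_contra h
        have : x ∈ Function.support g := h
        rw [hgs] at this
        exact hx this.1
      simp [hfg, this]
  have hCS : Λ K ≤ (∫⁻ ξ, ‖charFun Λ ((2 * Real.pi) • ξ)‖ₑ ^ 2) ^ (1 / 2 : ℝ)
      * (∫⁻ ξ, ‖𝓕 f ξ‖ₑ ^ 2) ^ (1 / 2 : ℝ) := by
    have hm1 : AEMeasurable (fun ξ : E => ‖charFun Λ ((2 * Real.pi) • ξ)‖ₑ) volume :=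
      ((measurable_charFun (μ := Λ)).comp (measurable_const_smul _)).enorm.aemeasurable
    have hm2 : AEMeasurable (fun ξ : E => ‖𝓕 f ξ‖ₑ) volume :=
      (𝓕 f).continuous.measurable.enorm.aemeasurable
    calc Λ K ≤ ‖∫ x, f x ∂Λ‖ₑ := hKle
      _ = ‖∫ ξ, charFun Λ ((2 * Real.pi) • ξ) * 𝓕 f ξ‖ₑ := by rw [integral_schwartz_eq]
      _ ≤ ∫⁻ ξ, ‖charFun Λ ((2 * Real.pi) • ξ) * 𝓕 f ξ‖ₑ := enorm_integral_le_lintegral_enorm _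
      _ = ∫⁻ ξ, ((fun ξ => ‖charFun Λ ((2 * Real.pi) • ξ)‖ₑ) * fun ξ => ‖𝓕 f ξ‖ₑ) ξ := by
          simp_rw [enorm_mul]; rfl
      _ ≤ _ := by
          simpa only [ENNReal.rpow_two] using
            ENNReal.lintegral_mul_le_Lp_mul_Lq volume Real.HolderConjugate.two_two hm1 hm2
  have hsq : ∀ a : ℝ≥0∞, (a ^ (1 / 2 : ℝ)) ^ 2 = a := fun a => by
    rw [← ENNReal.rpow_natCast, ← ENNReal.rpow_mul]; norm_num
  calc Λ K ^ 2 ≤ _ := pow_le_pow_left₀ (zero_le) hCS 2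
    _ = _ := by rw [mul_pow, hsq, hsq]
    _ ≤ _ := by gcongr

/-- A finite measure whose Fourier transform has `L²` norm at most `M^(1/2)` gives a set `A` mass at
most `(M |A|)^(1/2)`, as if by Cauchy-Schwarz for an `L²` density. -/
theorem sq_measure_le (Λ : Measure E) [IsFiniteMeasure Λ] (A : Set E) {M : ℝ≥0∞}
    (hM : ∫⁻ ξ, ‖charFun Λ ((2 * Real.pi) • ξ)‖ₑ ^ 2 ≤ M) (hMt : M ≠ ∞) :
    Λ A ^ 2 ≤ M * volume A := by
  have hopen : ∀ U : Set E, IsOpen U → Λ U ^ 2 ≤ M * volume U := by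
    intro U hU
    have hsq : ∀ a : ℝ≥0∞, (a ^ (1 / 2 : ℝ)) ^ 2 = a := fun a => by
      rw [← ENNReal.rpow_natCast, ← ENNReal.rpow_mul]; norm_num
    rw [← hsq (M * volume U)]
    refine pow_le_pow_left₀ (zero_le) ?_ 2
    rw [hU.measure_eq_iSup_isCompact]
    refine iSup₂_le fun K hKU => iSup_le fun hK => ?_
    rw [← ENNReal.pow_le_pow_left_iff two_ne_zero, hsq]
    exact (sq_measure_isCompact_le Λ hK hU hKU).trans (by gcongr)
  rcases eq_or_ne M 0 with rfl | hM0
  · have h := hopen univ isOpen_univ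
    rw [zero_mul] at h ⊢
    exact (pow_le_pow_left₀ (zero_le) (measure_mono (subset_univ A)) 2).trans h
  rw [A.measure_eq_iInf_isOpen volume]
  simp_rw [ENNReal.mul_iInf_of_ne hM0 hMt]
  exact le_iInf₂ fun U hAU => le_iInf fun hU =>
    (pow_le_pow_left₀ (zero_le) (measure_mono hAU) 2).trans (hopen U hU)

/-- The Gaussian-weighted `L²` norm of the Fourier transform of a measure is its Gaussian energy. -/
theorem lintegral_gaussian_mul_charFun_sq (μ : Measure E) [IsFiniteMeasure μ] {b : ℝ} (hb : 0 < b) :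
    ∫⁻ ξ, ENNReal.ofReal (Real.exp (-b * ‖ξ‖ ^ 2)) * ‖charFun μ ((2 * Real.pi) • ξ)‖ₑ ^ 2
      = ENNReal.ofReal ((Real.pi / b) ^ (Module.finrank ℝ E / 2 : ℝ))
        * ∫⁻ x, ∫⁻ y, ENNReal.ofReal (Real.exp (-(Real.pi ^ 2 / b) * ‖x - y‖ ^ 2)) ∂μ ∂μ := by
  set μ' := μ.map (fun x => (-1 : ℝ) • x) with hμ'
  set κ := μ.conv μ' with hκ
  have hκc : ∀ ξ, charFun κ ξ = ((‖charFun μ ξ‖ ^ 2 : ℝ) : ℂ) := by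
    intro ξ
    rw [hκ, charFun_conv, hμ', charFun_map_smul, neg_one_smul, charFun_neg, Complex.mul_conj,
      Complex.normSq_eq_norm_sq]
  have hbre : 0 < (b : ℂ).re := by simpa using hb
  -- The Fourier transform of the Gaussian, integrated against `κ`.
  have hmain : ∫ ξ, (Real.exp (-b * ‖ξ‖ ^ 2) : ℂ) * charFun κ ((2 * Real.pi) • ξ)
      = ∫ x, (((Real.pi / b) ^ (Module.finrank ℝ E / 2 : ℝ)
          * Real.exp (-(Real.pi ^ 2 / b) * ‖x‖ ^ 2) : ℝ) : ℂ) ∂κ := by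
    have h1 : ∀ ξ : E, (Real.exp (-b * ‖ξ‖ ^ 2) : ℂ) * charFun κ ((2 * Real.pi) • ξ)
        = ∫ x, Complex.exp (-b * ‖ξ‖ ^ 2 + (2 * Real.pi * Complex.I) * ⟪x, ξ⟫) ∂κ := by
      intro ξ
      rw [charFun_apply, ← integral_const_mul]
      refine integral_congr_ae (Eventually.of_forall fun x => ?_)
      simp only
      rw [Complex.ofReal_exp, ← Complex.exp_add, inner_smul_right]
      congr 1
      push_cast
      ring
    simp_rw [h1]
    rw [integral_integral_swap]
    · refine integral_congr_ae (Eventually.of_forall fun x => ?_)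
      simp only
      rw [GaussianFourier.integral_cexp_neg_mul_sq_norm_add hbre]
      rw [Complex.ofReal_mul, Complex.ofReal_cpow (by positivity), Complex.ofReal_exp]
      congr 1
      · push_cast; rfl
      · congr 1
        push_cast
        have : (b : ℂ) ≠ 0 := by exact_mod_cast hb.ne'
        field_simp
        rw [Complex.I_sq]
        ring
    · have hg : Integrable (fun ξ : E => Complex.exp (-b * ‖ξ‖ ^ 2)) volume := by
        simpa using GaussianFourier.integrable_cexp_neg_mul_sq_norm_add hbre 0 (0 : E)
      have hi : Integrable (fun p : E × E => Complex.exp (-b * ‖p.1‖ ^ 2)) (volume.prod κ) :=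
        hg.comp_fst κ
      refine hi.mono ?_ (Eventually.of_forall fun p => ?_)
      · refine Continuous.aestronglyMeasurable ?_
        fun_prop
      · simp only [Function.uncurry]
        rw [Complex.exp_add, norm_mul, show 2 * Real.pi * Complex.I * (⟪p.2, p.1⟫ : ℂ)
          = ((2 * Real.pi * ⟪p.2, p.1⟫ : ℝ) : ℂ) * Complex.I by push_cast; ring,
          Complex.norm_exp_ofReal_mul_I, mul_one]
  have hmain' : ∫ ξ, Real.exp (-b * ‖ξ‖ ^ 2) * ‖charFun μ ((2 * Real.pi) • ξ)‖ ^ 2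
      = ∫ x, (Real.pi / b) ^ (Module.finrank ℝ E / 2 : ℝ)
          * Real.exp (-(Real.pi ^ 2 / b) * ‖x‖ ^ 2) ∂κ := by
    rw [integral_complex_ofReal] at hmain
    simp_rw [hκc, ← Complex.ofReal_mul] at hmain
    rw [integral_complex_ofReal] at hmain
    exact_mod_cast hmain
  have hi1 : Integrable (fun ξ : E => Real.exp (-b * ‖ξ‖ ^ 2)
      * ‖charFun μ ((2 * Real.pi) • ξ)‖ ^ 2) volume := by
    have hg : Integrable (fun ξ : E => Real.exp (-b * ‖ξ‖ ^ 2)) volume := by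
      have := (GaussianFourier.integrable_cexp_neg_mul_sq_norm_add hbre 0 (0 : E)).norm
      refine this.congr (Eventually.of_forall fun ξ => ?_)
      simp [Complex.norm_exp, ← Complex.ofReal_pow]
    refine hg.mul_bdd (c := (μ.real univ) ^ 2) ?_ ?_
    · exact ((measurable_charFun (μ := μ)).comp
        (measurable_const_smul _)).norm.pow_const 2 |>.aestronglyMeasurable
    · refine Eventually.of_forall fun ξ => ?_
      rw [norm_pow, norm_norm]
      gcongr
      exact norm_charFun_le _
  have hi2 : Integrable (fun x : E => (Real.pi / b) ^ (Module.finrank ℝ E / 2 : ℝ)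
          * Real.exp (-(Real.pi ^ 2 / b) * ‖x‖ ^ 2)) κ := by
    refine Integrable.const_mul ?_ _
    refine Integrable.of_bound (C := 1) (by fun_prop) (Eventually.of_forall fun x => ?_)
    rw [Real.norm_of_nonneg (Real.exp_nonneg _), Real.exp_le_one_iff]
    have : 0 ≤ (Real.pi ^ 2 / b) * ‖x‖ ^ 2 := by positivity
    linarith
  have hm : Measurable fun x : E => ENNReal.ofReal (Real.exp (-(Real.pi ^ 2 / b) * ‖x‖ ^ 2)) := by
    fun_prop
  have hfin : ∫⁻ x, ENNReal.ofReal (Real.exp (-(Real.pi ^ 2 / b) * ‖x‖ ^ 2)) ∂κ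
      = ∫⁻ x, ∫⁻ y, ENNReal.ofReal (Real.exp (-(Real.pi ^ 2 / b) * ‖x - y‖ ^ 2)) ∂μ ∂μ := by
    rw [hκ, Measure.lintegral_conv hm]
    refine lintegral_congr fun x => ?_
    have hmx : Measurable fun y : E =>
        ENNReal.ofReal (Real.exp (-(Real.pi ^ 2 / b) * ‖x + y‖ ^ 2)) := by fun_prop
    rw [hμ', lintegral_map hmx (by fun_prop)]
    simp [sub_eq_add_neg]
  have h2 := congrArg ENNReal.ofReal hmain'
  rw [ofReal_integral_eq_lintegral_ofReal hi1 (Eventually.of_forall fun x => by positivity),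
    ofReal_integral_eq_lintegral_ofReal hi2 (Eventually.of_forall fun x => by positivity)] at h2
  rw [← hfin, ← lintegral_const_mul _ hm]
  calc _ = _ := ?_
    _ = _ := h2
    _ = _ := ?_
  · refine lintegral_congr fun ξ => ?_
    rw [ENNReal.ofReal_mul (Real.exp_nonneg _), ENNReal.ofReal_pow (norm_nonneg _),
      ofReal_norm]
  · refine lintegral_congr fun x => ?_
    rw [ENNReal.ofReal_mul (by positivity)]

/-! ### Frostman measures and Fourier decay -/

theorem summable_exp_neg_mul_add_one_rpow (u : ℝ) :
    Summable fun j : ℕ => Real.exp (-j) * (j + 1 : ℝ) ^ u := by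
  have h := (summable_nat_add_iff 1).2 (Real.summable_pow_mul_exp_neg_nat_mul ⌈u⌉₊ one_pos)
  refine (h.mul_left (Real.exp 1)).of_nonneg_of_le (fun j => by positivity) fun j => ?_
  have h1 : (j + 1 : ℝ) ^ u ≤ (j + 1 : ℝ) ^ ⌈u⌉₊ := by
    rw [← Real.rpow_natCast]
    exact Real.rpow_le_rpow_of_exponent_le (by linarith [Nat.cast_nonneg (α := ℝ) j])
      (Nat.le_ceil u)
  have h2 : Real.exp (-j) = Real.exp 1 * Real.exp (-1 * (j + 1)) := by
    rw [← Real.exp_add]; congr 1; ring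
  rw [h2]
  push_cast
  calc _ ≤ Real.exp 1 * Real.exp (-1 * (j + 1)) * (j + 1 : ℝ) ^ ⌈u⌉₊ := by gcongr
    _ = _ := by ring

/-- The Gaussian potential at scale `t` of a measure whose balls about `x` satisfy
`μ(B(x, R)) ≤ B R^u` is at most a constant times `B t^u`. -/
theorem exists_lintegral_gaussian_le {F : Type*} [NormedAddCommGroup F] [MeasurableSpace F]
    [BorelSpace F] (u : ℝ) : ∃ K : ℝ, 0 ≤ K ∧ ∀ (μ : Measure F) (x : F) (B : ℝ), 0 ≤ B →
      (∀ R : ℝ, 0 < R → μ (ball x R) ≤ ENNReal.ofReal (B * R ^ u)) → ∀ t : ℝ, 0 < t →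
      ∫⁻ y, ENNReal.ofReal (Real.exp (-(Real.pi ^ 2 / t ^ 2) * ‖x - y‖ ^ 2)) ∂μ
        ≤ ENNReal.ofReal (K * B * t ^ u) := by
  have hsum := summable_exp_neg_mul_add_one_rpow u
  refine ⟨∑' j : ℕ, Real.exp (-j) * (j + 1 : ℝ) ^ u, tsum_nonneg fun j => by positivity,
    fun μ x B hB hμ t ht => ?_⟩
  -- On the shell `j ≤ ‖x - y‖ / t < j + 1` the Gaussian is at most `exp (-j)`.
  have hpt : ∀ y, ENNReal.ofReal (Real.exp (-(Real.pi ^ 2 / t ^ 2) * ‖x - y‖ ^ 2))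
      ≤ ∑' j : ℕ, (ball x ((j + 1) * t)).indicator (fun _ => ENNReal.ofReal (Real.exp (-j))) y := by
    intro y
    set a := ‖x - y‖ / t with ha
    have ha0 : 0 ≤ a := by positivity
    refine le_trans ?_ (ENNReal.le_tsum ⌊a⌋₊)
    have hy : y ∈ ball x ((⌊a⌋₊ + 1) * t) := by
      rw [mem_ball', dist_eq_norm, ← div_lt_iff₀ ht]
      exact Nat.lt_floor_add_one a
    rw [indicator_of_mem hy]
    refine ENNReal.ofReal_le_ofReal (Real.exp_le_exp.2 ?_)
    have h1 : Real.pi ^ 2 / t ^ 2 * ‖x - y‖ ^ 2 = Real.pi ^ 2 * a ^ 2 := by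
      rw [ha, div_pow]; ring
    rw [neg_mul, h1, neg_le_neg_iff]
    have h2 : (⌊a⌋₊ : ℝ) ≤ a := Nat.floor_le ha0
    have h3 : (⌊a⌋₊ : ℝ) ≤ (⌊a⌋₊ : ℝ) ^ 2 := by
      exact_mod_cast Nat.le_self_pow two_ne_zero _
    have h4 : (1 : ℝ) ≤ Real.pi ^ 2 := one_le_pow₀ (by linarith [Real.pi_gt_three])
    calc (⌊a⌋₊ : ℝ) ≤ (⌊a⌋₊ : ℝ) ^ 2 := h3
      _ ≤ a ^ 2 := by gcongr
      _ ≤ _ := le_mul_of_one_le_left (by positivity) h4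
  calc _ ≤ _ := lintegral_mono hpt
    _ = ∑' j : ℕ, ENNReal.ofReal (Real.exp (-j)) * μ (ball x ((j + 1) * t)) := by
        rw [lintegral_tsum fun j =>
          (measurable_const.indicator measurableSet_ball).aemeasurable]
        simp_rw [lintegral_indicator_const measurableSet_ball]
    _ ≤ ∑' j : ℕ, ENNReal.ofReal (Real.exp (-j) * (j + 1 : ℝ) ^ u * (B * t ^ u)) := by
        refine ENNReal.tsum_le_tsum fun j => ?_
        refine (mul_le_mul' le_rfl (hμ _ (by positivity))).trans ?_
        rw [← ENNReal.ofReal_mul (by positivity), Real.mul_rpow (by positivity) ht.le]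
        exact le_of_eq (by congr 1; ring)
    _ = _ := by
        rw [← ENNReal.ofReal_tsum_of_nonneg (fun j => by positivity) (hsum.mul_right _),
          tsum_mul_right, mul_assoc]

/-- Power decay of a function that is bounded by `1` is expressed as a bound by a series of
Gaussians with widths along a geometric sequence. -/
theorem exists_sq_le_tsum_gaussian {F : Type*} [NormedAddCommGroup F] {φ : F → ℂ}
    (hφ1 : ∀ ξ, ‖φ ξ‖ ≤ 1) {σ C : ℝ} (hσ : 0 < σ)
    (hφ : ∀ ξ, ξ ≠ 0 → ‖φ ξ‖ ≤ C * ‖ξ‖ ^ (-σ)) {ρ : ℝ} (hρ0 : 0 < ρ) (hρ1 : ρ < 1) :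
    ∃ C' : ℝ, 0 ≤ C' ∧ ∀ ξ, ‖φ ξ‖ₑ ^ 2
      ≤ ∑' k : ℕ, ENNReal.ofReal (C' * (ρ ^ k) ^ (2 * σ))
          * ENNReal.ofReal (Real.exp (-(ρ ^ k) ^ 2 * ‖ξ‖ ^ 2)) := by
  set D := max 1 ((C * ρ ^ (-σ)) ^ 2) with hD
  have hD1 : 1 ≤ D := le_max_left _ _
  refine ⟨Real.exp 1 * D, by positivity, fun ξ => ?_⟩
  suffices h : ∃ k : ℕ, ‖φ ξ‖ ^ 2
      ≤ Real.exp 1 * D * (ρ ^ k) ^ (2 * σ) * Real.exp (-(ρ ^ k) ^ 2 * ‖ξ‖ ^ 2) by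
    obtain ⟨k, hk⟩ := h
    refine le_trans ?_ (ENNReal.le_tsum k)
    rw [← ENNReal.ofReal_mul (by positivity), ← ofReal_norm, ← ENNReal.ofReal_pow (norm_nonneg _)]
    exact ENNReal.ofReal_le_ofReal hk
  -- If `ρᵏ ‖ξ‖ ≤ 1`, then the Gaussian factor is bounded below by `exp (-1)`.
  have hexp : ∀ k : ℕ, ρ ^ k * ‖ξ‖ ≤ 1 → ‖φ ξ‖ ^ 2 ≤ D * (ρ ^ k) ^ (2 * σ) → ‖φ ξ‖ ^ 2
      ≤ Real.exp 1 * D * (ρ ^ k) ^ (2 * σ) * Real.exp (-(ρ ^ k) ^ 2 * ‖ξ‖ ^ 2) := by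
    intro k hk h
    have h1 : 1 ≤ Real.exp 1 * Real.exp (-(ρ ^ k) ^ 2 * ‖ξ‖ ^ 2) := by
      rw [← Real.exp_add, Real.one_le_exp_iff, neg_mul, ← mul_pow]
      linarith [pow_le_one₀ (n := 2) (by positivity) hk]
    calc _ ≤ D * (ρ ^ k) ^ (2 * σ) := h
      _ ≤ D * (ρ ^ k) ^ (2 * σ) * (Real.exp 1 * Real.exp (-(ρ ^ k) ^ 2 * ‖ξ‖ ^ 2)) :=
          le_mul_of_one_le_right (by positivity) h1
      _ = _ := by ring
  rcases le_or_gt ‖ξ‖ 1 with hξ | hξ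
  · refine ⟨0, hexp 0 (by simpa using hξ) ?_⟩
    rw [pow_zero, Real.one_rpow, mul_one]
    exact (pow_le_one₀ (norm_nonneg _) (hφ1 ξ)).trans hD1
  · have hξ0 : 0 < ‖ξ‖ := one_pos.trans hξ
    obtain ⟨n, hn1, hn2⟩ := exists_nat_pow_near_of_lt_one (inv_pos.2 hξ0)
      (inv_le_one_of_one_le₀ hξ.le) hρ0 hρ1
    refine ⟨n + 1, hexp (n + 1) ?_ ?_⟩
    · rw [← le_div_iff₀ hξ0, one_div]
      exact hn1.le
    · have hC0 : 0 ≤ C := by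
        have := (norm_nonneg _).trans (hφ ξ (norm_pos_iff.1 hξ0))
        exact nonneg_of_mul_nonneg_left this (by positivity)
      have h1 : ‖φ ξ‖ ≤ C * ρ ^ (-σ) * (ρ ^ (n + 1)) ^ σ := by
        calc ‖φ ξ‖ ≤ C * ‖ξ‖ ^ (-σ) := hφ ξ (norm_pos_iff.1 hξ0)
          _ = C * (‖ξ‖⁻¹) ^ σ := by rw [Real.rpow_neg hξ0.le, Real.inv_rpow hξ0.le]
          _ ≤ C * (ρ ^ n) ^ σ := by gcongr
          _ = _ := by
              rw [pow_succ, Real.mul_rpow (by positivity) hρ0.le, Real.rpow_neg hρ0.le]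
              field_simp
      calc ‖φ ξ‖ ^ 2 ≤ (C * ρ ^ (-σ) * (ρ ^ (n + 1)) ^ σ) ^ 2 := by gcongr
        _ = (C * ρ ^ (-σ)) ^ 2 * (ρ ^ (n + 1)) ^ (2 * σ) := by
            rw [mul_pow, ← Real.rpow_natCast ((ρ ^ (n + 1)) ^ σ), ← Real.rpow_mul (by positivity),
              mul_comm σ]
            norm_num
        _ ≤ _ := by gcongr; exact le_max_right _ _

/-- The `L²` bound on the Fourier side. If `μ` satisfies a Frostman condition with exponent
`u > d - 2σ`, and the Fourier transform of `η` decays with exponent `σ`, then `μ ∗ η` has a square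
integrable Fourier transform. -/
theorem exists_lintegral_charFun_conv_sq_le {η : Measure E} [IsProbabilityMeasure η] {σ C : ℝ}
    (hσ : 0 < σ) (hη : ∀ ξ, ξ ≠ 0 → ‖charFun η ((2 * Real.pi) • ξ)‖ ≤ C * ‖ξ‖ ^ (-σ))
    {ρ : ℝ} (hρ0 : 0 < ρ) (hρ1 : ρ < 1) {u : ℝ} (hu : Module.finrank ℝ E < u + 2 * σ) :
    ∃ K : ℝ, 0 ≤ K ∧ ∀ (μ : Measure E) [IsFiniteMeasure μ] (B : ℝ), μ univ ≤ 1 → 0 ≤ B →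
      (∀ᵐ x ∂μ, ∀ R : ℝ, 0 < R → μ (ball x R) ≤ ENNReal.ofReal (B * R ^ u)) →
        ∫⁻ ξ, ‖charFun (μ.conv η) ((2 * Real.pi) • ξ)‖ₑ ^ 2 ≤ ENNReal.ofReal (K * B) := by
  obtain ⟨C', hC'0, hC'⟩ := exists_sq_le_tsum_gaussian
    (φ := fun ξ => charFun η ((2 * Real.pi) • ξ)) (fun ξ => norm_charFun_le_one _) hσ hη hρ0 hρ1
  obtain ⟨K₁, hK₁0, hK₁⟩ := exists_lintegral_gaussian_le (F := E) u
  set d := Module.finrank ℝ E with hd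
  set α := u + 2 * σ - d with hα
  have hα0 : 0 < α := by linarith
  have hgeom : Summable fun k : ℕ => (ρ ^ α) ^ k :=
    summable_geometric_of_lt_one (by positivity) (Real.rpow_lt_one hρ0.le hρ1 hα0)
  set P := Real.pi ^ (d / 2 : ℝ) with hP
  have hP0 : 0 ≤ P := by positivity
  refine ⟨C' * P * K₁ * ∑' k : ℕ, (ρ ^ α) ^ k,
    mul_nonneg (by positivity) (tsum_nonneg fun k => by positivity), fun μ _ B hμ1 hB hμ => ?_⟩
  have hterm : ∀ k : ℕ, ∫⁻ ξ, ENNReal.ofReal (C' * (ρ ^ k) ^ (2 * σ))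
        * ENNReal.ofReal (Real.exp (-(ρ ^ k) ^ 2 * ‖ξ‖ ^ 2))
        * ‖charFun μ ((2 * Real.pi) • ξ)‖ₑ ^ 2
      ≤ ENNReal.ofReal (C' * P * K₁ * B * (ρ ^ α) ^ k) := by
    intro k
    set t := ρ ^ k with ht
    have ht0 : 0 < t := by positivity
    simp_rw [mul_assoc (ENNReal.ofReal (C' * t ^ (2 * σ)))]
    rw [lintegral_const_mul' _ _ ENNReal.ofReal_ne_top,
      lintegral_gaussian_mul_charFun_sq μ (by positivity : 0 < t ^ 2)]
    have hpot : ∫⁻ x, ∫⁻ y, ENNReal.ofReal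
        (Real.exp (-(Real.pi ^ 2 / t ^ 2) * ‖x - y‖ ^ 2)) ∂μ ∂μ
          ≤ ENNReal.ofReal (K₁ * B * t ^ u) := by
      calc _ ≤ ∫⁻ _, ENNReal.ofReal (K₁ * B * t ^ u) ∂μ := by
            refine lintegral_mono_ae ?_
            filter_upwards [hμ] with x hx
            exact hK₁ μ x B hB hx t ht0
        _ ≤ _ := by
            rw [lintegral_const]
            exact mul_le_of_le_one_right (zero_le) hμ1
    calc _ ≤ ENNReal.ofReal (C' * t ^ (2 * σ)) * (ENNReal.ofReal ((Real.pi / t ^ 2) ^ (d / 2 : ℝ))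
            * ENNReal.ofReal (K₁ * B * t ^ u)) := by gcongr
      _ = _ := by
          rw [← ENNReal.ofReal_mul (by positivity), ← ENNReal.ofReal_mul (by positivity)]
          congr 1
          have h1 : (t ^ 2) ^ (d / 2 : ℝ) = t ^ (d : ℝ) := by
            rw [← Real.rpow_natCast t 2, ← Real.rpow_mul ht0.le]; congr 1; push_cast; ring
          have h2 : (ρ ^ α) ^ k = t ^ u * t ^ (2 * σ) / t ^ (d : ℝ) := by
            rw [← Real.rpow_add ht0, ← Real.rpow_sub ht0, ← hα, ht, ← Real.rpow_natCast,
              ← Real.rpow_natCast, ← Real.rpow_mul hρ0.le, ← Real.rpow_mul hρ0.le, mul_comm]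
          rw [Real.div_rpow Real.pi_pos.le (by positivity), h1, h2]
          ring
  calc ∫⁻ ξ, ‖charFun (μ.conv η) ((2 * Real.pi) • ξ)‖ₑ ^ 2
      ≤ ∫⁻ ξ, ∑' k : ℕ, ENNReal.ofReal (C' * (ρ ^ k) ^ (2 * σ))
        * ENNReal.ofReal (Real.exp (-(ρ ^ k) ^ 2 * ‖ξ‖ ^ 2))
        * ‖charFun μ ((2 * Real.pi) • ξ)‖ₑ ^ 2 := by
        refine lintegral_mono fun ξ => ?_
        rw [charFun_conv, enorm_mul, mul_pow, mul_comm, ENNReal.tsum_mul_right]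
        exact mul_le_mul' (hC' ξ) le_rfl
    _ = ∑' k : ℕ, ∫⁻ ξ, ENNReal.ofReal (C' * (ρ ^ k) ^ (2 * σ))
        * ENNReal.ofReal (Real.exp (-(ρ ^ k) ^ 2 * ‖ξ‖ ^ 2))
        * ‖charFun μ ((2 * Real.pi) • ξ)‖ₑ ^ 2 := by
        refine lintegral_tsum fun k => Measurable.aemeasurable ?_
        have : Measurable fun ξ : E => ‖charFun μ ((2 * Real.pi) • ξ)‖ₑ ^ 2 :=
          ((measurable_charFun (μ := μ)).comp (measurable_const_smul _)).enorm.pow_const 2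
        fun_prop
    _ ≤ ∑' k : ℕ, ENNReal.ofReal (C' * P * K₁ * B * (ρ ^ α) ^ k) :=
        ENNReal.tsum_le_tsum hterm
    _ = _ := by
        rw [← ENNReal.ofReal_tsum_of_nonneg (fun k => by positivity) (hgeom.mul_left _),
          tsum_mul_left]
        congr 1; ring

/-- If outside of small mass `ν` satisfies a Frostman condition, and the Fourier transform of `η`
decays, then `ν ∗ η` splits at every scale `n` into a part of exponentially small mass and a part
with an `L²` bound growing with `n`. -/
theorem exists_conv_apply_le {ν η : Measure E} [IsProbabilityMeasure ν] [IsProbabilityMeasure η]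
    {σ C : ℝ} (hσ : 0 < σ)
    (hη : ∀ ξ, ξ ≠ 0 → ‖charFun η ((2 * Real.pi) • ξ)‖ ≤ C * ‖ξ‖ ^ (-σ))
    {ρ δ K u : ℝ} (hρ0 : 0 < ρ) (hρ1 : ρ < 1) (hδ : 0 < δ) (hK : 0 ≤ K) (hu0 : 0 ≤ u)
    (hu : Module.finrank ℝ E < u + 2 * σ)
    (hν : ∀ k : ℕ, ν {x | ENNReal.ofReal ((ρ ^ k) ^ u) < ν (ball x (ρ ^ k))}
        ≤ ENNReal.ofReal (K * (ρ ^ k) ^ δ)) :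
    ∃ K₁ K₂ : ℝ, 0 ≤ K₁ ∧ 0 ≤ K₂ ∧ ∀ (n : ℕ) (A : Set E),
      ν.conv η A ≤ ENNReal.ofReal (K₁ * (ρ ^ n) ^ δ)
        + (ENNReal.ofReal (K₂ * (ρ ^ n) ^ (-u)) * volume A) ^ (1 / 2 : ℝ) := by
  obtain ⟨K₂, hK₂0, hK₂⟩ := exists_lintegral_charFun_conv_sq_le hσ hη hρ0 hρ1 hu
  have hgeom : Summable fun k : ℕ => (ρ ^ δ) ^ k :=
    summable_geometric_of_lt_one (by positivity) (Real.rpow_lt_one hρ0.le hρ1 hδ)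
  refine ⟨K * ∑' k : ℕ, (ρ ^ δ) ^ k, K₂ * ρ ^ (-u),
    mul_nonneg hK (tsum_nonneg fun k => by positivity), by positivity, fun n A => ?_⟩
  set bad : Set E := ⋃ k : ℕ,
    {x | ENNReal.ofReal ((ρ ^ (n + k)) ^ u) < ν (ball x (ρ ^ (n + k)))} with hbad
  have hbadm : MeasurableSet bad := MeasurableSet.iUnion fun k =>
    measurableSet_lt measurable_const (measurable_measure_ball ν _)
  have hbadν : ν bad ≤ ENNReal.ofReal (K * (∑' k : ℕ, (ρ ^ δ) ^ k) * (ρ ^ n) ^ δ) := by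
    calc ν bad ≤ ∑' k : ℕ, ENNReal.ofReal (K * (ρ ^ n) ^ δ * (ρ ^ δ) ^ k) := by
          refine (measure_iUnion_le _).trans (ENNReal.tsum_le_tsum fun k => (hν (n + k)).trans ?_)
          refine ENNReal.ofReal_le_ofReal (le_of_eq ?_)
          rw [pow_add, Real.mul_rpow (by positivity) (by positivity), ← Real.rpow_natCast ρ k,
            ← Real.rpow_natCast (ρ ^ δ) k, ← Real.rpow_mul hρ0.le, ← Real.rpow_mul hρ0.le,
            mul_comm (k : ℝ), mul_assoc]
      _ = _ := by
          rw [← ENNReal.ofReal_tsum_of_nonneg (fun k => by positivity) (hgeom.mul_left _),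
            tsum_mul_left]
          congr 1; ring
  -- Off `bad` the measure satisfies the Frostman condition with constant `ρ^(-(n + 1) u)`.
  have hgood : ∀ x ∈ badᶜ, ∀ R : ℝ, 0 < R →
      ν (ball x R) ≤ ENNReal.ofReal ((ρ ^ (n + 1)) ^ (-u) * R ^ u) := by
    intro x hx R hR
    have hsplit : ∀ k : ℕ, (ρ ^ k) ^ (-u) * R ^ u = (R / ρ ^ k) ^ u := fun k => by
      rw [Real.div_rpow hR.le (by positivity), Real.rpow_neg (by positivity)]
      field_simp
    rw [hsplit]
    rcases le_or_gt (ρ ^ (n + 1)) R with hR1 | hR1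
    · refine prob_le_one.trans ?_
      rw [ENNReal.one_le_ofReal]
      exact Real.one_le_rpow ((one_le_div (by positivity)).2 hR1) hu0
    · obtain ⟨k, hk1, hk2⟩ := exists_nat_pow_near_of_lt_one (x := R / ρ ^ n) (by positivity)
        ((div_le_one (by positivity)).2 (hR1.le.trans
          (pow_le_pow_of_le_one hρ0.le hρ1.le (Nat.le_succ n)))) hρ0 hρ1
      rw [lt_div_iff₀ (by positivity), ← pow_add] at hk1
      rw [div_le_iff₀ (by positivity), ← pow_add] at hk2
      have hx' : ν (ball x (ρ ^ (n + k))) ≤ ENNReal.ofReal ((ρ ^ (n + k)) ^ u) := by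
        by_contra hlt
        exact hx (mem_iUnion.2 ⟨k, not_le.1 hlt⟩)
      rw [add_comm] at hk2
      refine (measure_mono (ball_subset_ball hk2)).trans (hx'.trans ?_)
      refine ENNReal.ofReal_le_ofReal (Real.rpow_le_rpow (by positivity) ?_ hu0)
      rw [le_div_iff₀ (by positivity), ← pow_add]
      refine le_trans ?_ hk1.le
      exact pow_le_pow_of_le_one hρ0.le hρ1.le (by omega)
  have hL2 : ((ν.restrict badᶜ).conv η A) ^ 2
      ≤ ENNReal.ofReal (K₂ * (ρ ^ (n + 1)) ^ (-u)) * volume A := by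
    refine sq_measure_le _ A (hK₂ _ _ ?_ (by positivity) ?_) ENNReal.ofReal_ne_top
    · rw [Measure.restrict_apply_univ]; exact prob_le_one
    · filter_upwards [ae_restrict_mem hbadm.compl] with x hx R hR
      exact (Measure.restrict_apply_le _ _).trans (hgood x hx R hR)
  have hexp : K₂ * (ρ ^ (n + 1)) ^ (-u) = K₂ * ρ ^ (-u) * (ρ ^ n) ^ (-u) := by
    rw [pow_succ, Real.mul_rpow (by positivity) hρ0.le]; ring
  rw [hexp] at hL2
  have hsum : ν.conv η = (ν.restrict bad).conv η + (ν.restrict badᶜ).conv η := by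
    rw [← Measure.add_conv, Measure.restrict_add_restrict_compl hbadm]
  rw [hsum, Measure.add_apply]
  gcongr
  · refine (measure_mono (subset_univ A)).trans (le_trans (le_of_eq ?_) hbadν)
    rw [← setLIntegral_one, Measure.restrict_univ, Measure.lintegral_conv measurable_const]
    simp
  · have hsq : ∀ a : ℝ≥0∞, (a ^ (1 / 2 : ℝ)) ^ 2 = a := fun a => by
      rw [← ENNReal.rpow_natCast, ← ENNReal.rpow_mul]; norm_num
    rwa [← ENNReal.pow_le_pow_left_iff two_ne_zero, hsq]

/-! ### From a power bound to an `L^q` density -/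

/-- Optimizing the scale in the splitting `μ = (small mass) + (L² part)` gives a power bound of
`μ(A)` in terms of the reference measure of `A`. -/
theorem exists_measure_le_rpow {α : Type*} [MeasurableSpace α] {μ vol : Measure α}
    [IsProbabilityMeasure μ] {ρ δ u K₁ K₂ : ℝ} (hρ0 : 0 < ρ) (hρ1 : ρ < 1) (hδ : 0 < δ)
    (hu : 0 < u) (hK₁ : 0 ≤ K₁) (hK₂ : 0 ≤ K₂)
    (h : ∀ (n : ℕ) (A : Set α), μ A ≤ ENNReal.ofReal (K₁ * (ρ ^ n) ^ δ)
        + (ENNReal.ofReal (K₂ * (ρ ^ n) ^ (-u)) * vol A) ^ (1 / 2 : ℝ)) :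
    ∃ C θ : ℝ, 0 < θ ∧ ∀ A : Set α, μ A ≤ ENNReal.ofReal C * vol A ^ θ := by
  set θ := min (1 / 4) (δ / (2 * u)) with hθ
  have hθ0 : 0 < θ := by positivity
  set C := K₁ * ρ ^ (-δ) + K₂ ^ (1 / 2 : ℝ) + 1 with hC
  have hC1 : 1 ≤ C := by
    have : 0 ≤ K₁ * ρ ^ (-δ) := by positivity
    have : 0 ≤ K₂ ^ (1 / 2 : ℝ) := by positivity
    linarith
  refine ⟨C, θ, hθ0, fun A => ?_⟩
  rcases eq_or_ne (vol A) 0 with h0 | h0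
  · have hlim : Tendsto (fun n : ℕ => ENNReal.ofReal (K₁ * (ρ ^ n) ^ δ)) atTop (𝓝 0) := by
      have h1 : Tendsto (fun n : ℕ => K₁ * (ρ ^ δ) ^ n) atTop (𝓝 (K₁ * 0)) :=
        (tendsto_pow_atTop_nhds_zero_of_lt_one (by positivity)
          (Real.rpow_lt_one hρ0.le hρ1 hδ)).const_mul _
      have h2 : ∀ n : ℕ, (ρ ^ n) ^ δ = (ρ ^ δ) ^ n := fun n => by
        rw [← Real.rpow_natCast, ← Real.rpow_natCast, ← Real.rpow_mul hρ0.le,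
          ← Real.rpow_mul hρ0.le, mul_comm]
      simp_rw [h2]
      simpa using ENNReal.tendsto_ofReal h1
    have hA : μ A = 0 := by
      refine le_antisymm (ge_of_tendsto' hlim fun n => ?_) (zero_le)
      simpa [h0] using h n A
    rw [hA]; exact zero_le
  rcases le_or_gt 1 (vol A) with hv1 | hv1
  · refine prob_le_one.trans ?_
    exact one_le_mul (by rwa [ENNReal.one_le_ofReal]) (ENNReal.one_le_rpow hv1 hθ0)
  obtain ⟨v, hv⟩ : ∃ v : ℝ, v = (vol A).toReal := ⟨_, rfl⟩
  have hvA : vol A = ENNReal.ofReal v := by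
    rw [hv, ENNReal.ofReal_toReal (hv1.trans ENNReal.one_lt_top).ne]
  have hv0 : 0 < v := hv ▸ ENNReal.toReal_pos h0 (hv1.trans ENNReal.one_lt_top).ne
  have hvle : v ≤ 1 := by
    rw [hvA, ENNReal.ofReal_lt_one] at hv1; exact hv1.le
  -- The scale `n` is chosen with `ρ^(2un)` comparable to `v`.
  obtain ⟨n, hn1, hn2⟩ := exists_nat_pow_near_of_lt_one hv0 hvle
    (by positivity : 0 < ρ ^ (2 * u)) (Real.rpow_lt_one hρ0.le hρ1 (by linarith))
  have hpow : ∀ k : ℕ, (ρ ^ (2 * u)) ^ k = (ρ ^ k) ^ (2 * u) := fun k => by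
    rw [← Real.rpow_natCast, ← Real.rpow_natCast, ← Real.rpow_mul hρ0.le,
      ← Real.rpow_mul hρ0.le, mul_comm]
  rw [hpow] at hn1 hn2
  have h1 : (ρ ^ n) ^ δ ≤ ρ ^ (-δ) * v ^ θ := by
    calc (ρ ^ n) ^ δ = ρ ^ (-δ) * ((ρ ^ (n + 1)) ^ (2 * u)) ^ (δ / (2 * u)) := by
          rw [← Real.rpow_mul (by positivity), mul_div_cancel₀ _ (by positivity), pow_succ,
            Real.mul_rpow (by positivity) hρ0.le, Real.rpow_neg hρ0.le]
          field_simp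
      _ ≤ ρ ^ (-δ) * v ^ (δ / (2 * u)) := by gcongr
      _ ≤ ρ ^ (-δ) * v ^ θ := by
          refine mul_le_mul_of_nonneg_left ?_ (by positivity)
          exact Real.rpow_le_rpow_of_exponent_ge hv0 hvle (min_le_right _ _)
  have h2 : (ρ ^ n) ^ (-u) * v ≤ v ^ (1 / 2 : ℝ) := by
    have h3 : v ^ (1 / 2 : ℝ) ≤ (ρ ^ n) ^ u := by
      calc v ^ (1 / 2 : ℝ) ≤ ((ρ ^ n) ^ (2 * u)) ^ (1 / 2 : ℝ) := by gcongr
        _ = _ := by rw [← Real.rpow_mul (by positivity)]; congr 1; ring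
    have h4 : v = v ^ (1 / 2 : ℝ) * v ^ (1 / 2 : ℝ) := by
      rw [← Real.rpow_add hv0]; norm_num
    calc _ = (ρ ^ n) ^ (-u) * (v ^ (1 / 2 : ℝ) * v ^ (1 / 2 : ℝ)) := by rw [← h4]
      _ ≤ (ρ ^ n) ^ (-u) * ((ρ ^ n) ^ u * v ^ (1 / 2 : ℝ)) := by gcongr
      _ = _ := by
          rw [← mul_assoc, ← Real.rpow_add (by positivity), neg_add_cancel, Real.rpow_zero,
            one_mul]
  have h5 : (K₂ * (ρ ^ n) ^ (-u) * v) ^ (1 / 2 : ℝ) ≤ K₂ ^ (1 / 2 : ℝ) * v ^ θ := by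
    calc _ ≤ (K₂ * v ^ (1 / 2 : ℝ)) ^ (1 / 2 : ℝ) := by
          rw [mul_assoc]; gcongr
      _ = K₂ ^ (1 / 2 : ℝ) * v ^ (1 / 4 : ℝ) := by
          rw [Real.mul_rpow hK₂ (by positivity), ← Real.rpow_mul hv0.le]; norm_num
      _ ≤ _ := by
          refine mul_le_mul_of_nonneg_left ?_ (by positivity)
          exact Real.rpow_le_rpow_of_exponent_ge hv0 hvle (min_le_left _ _)
  refine (h n A).trans ?_
  rw [hvA, ← ENNReal.ofReal_mul (by positivity),
    ENNReal.ofReal_rpow_of_nonneg (by positivity) (by norm_num),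
    ENNReal.ofReal_rpow_of_nonneg hv0.le hθ0.le, ← ENNReal.ofReal_add (by positivity)
    (by positivity), ← ENNReal.ofReal_mul (by positivity)]
  refine ENNReal.ofReal_le_ofReal ?_
  have h6 : K₁ * (ρ ^ n) ^ δ ≤ K₁ * (ρ ^ (-δ) * v ^ θ) := by gcongr
  have h7 : 0 ≤ v ^ θ := by positivity
  calc _ ≤ K₁ * (ρ ^ (-δ) * v ^ θ) + K₂ ^ (1 / 2 : ℝ) * v ^ θ := add_le_add h6 h5
    _ ≤ _ := by rw [hC]; linarith

/-- A probability measure with `μ(A) ≤ C vol(A)^θ` is absolutely continuous, with density in `L^q`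
for `q = 1 + θ / 2`. Testing on the superlevel sets of the density `f` gives
`μ(f ≥ t) ≤ C t^(-θ)`, so that `∫ f^(θ / 2) dμ` is finite. -/
theorem absolutelyContinuous_and_memLp_of_measure_le_rpow {α : Type*} [MeasurableSpace α]
    {μ vol : Measure α} [IsProbabilityMeasure μ] [SigmaFinite vol] {C θ : ℝ} (hθ : 0 < θ)
    (h : ∀ A : Set α, μ A ≤ ENNReal.ofReal C * vol A ^ θ) :
    μ ≪ vol ∧ ∃ q : ℝ, 1 < q ∧
      MemLp (fun x => (μ.rnDeriv vol x).toReal) (ENNReal.ofReal q) vol := by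
  have hac : μ ≪ vol := fun A hA => by
    have := h A
    rwa [hA, ENNReal.zero_rpow_of_pos hθ, mul_zero, nonpos_iff_eq_zero] at this
  refine ⟨hac, 1 + θ / 2, by linarith, ?_⟩
  set f := μ.rnDeriv vol with hf
  have hfm : Measurable f := Measure.measurable_rnDeriv _ _
  have hμf : vol.withDensity f = μ := Measure.withDensity_rnDeriv_eq _ _ hac
  have hlevel : ∀ t : ℝ, 0 < t →
      μ {x | ENNReal.ofReal t ≤ f x} ≤ ENNReal.ofReal C * ENNReal.ofReal (t ^ (-θ)) := by
    intro t ht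
    set F := {x | ENNReal.ofReal t ≤ f x} with hF
    have hFm : MeasurableSet F := measurableSet_le measurable_const hfm
    have h1 : ENNReal.ofReal t * vol F ≤ 1 := by
      calc ENNReal.ofReal t * vol F = ∫⁻ _ in F, ENNReal.ofReal t ∂vol := by
            rw [setLIntegral_const]
        _ ≤ ∫⁻ x in F, f x ∂vol := setLIntegral_mono hfm fun x hx => hx
        _ = μ F := by rw [← withDensity_apply _ hFm, hμf]
        _ ≤ 1 := prob_le_one
    have h2 : vol F ≤ ENNReal.ofReal t⁻¹ := by
      rw [ENNReal.ofReal_inv_of_pos ht, ← one_div]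
      refine (ENNReal.le_div_iff_mul_le (Or.inl (by simpa using ht))
        (Or.inl ENNReal.ofReal_ne_top)).2 ?_
      rwa [mul_comm]
    refine (h F).trans ?_
    gcongr
    refine (ENNReal.rpow_le_rpow h2 hθ.le).trans (le_of_eq ?_)
    rw [ENNReal.ofReal_rpow_of_nonneg (by positivity) hθ.le, Real.inv_rpow ht.le,
      Real.rpow_neg ht.le]
  have hmoment : ∫⁻ x, f x ^ (θ / 2) ∂μ < ∞ := by
    -- Dyadic decomposition of the values of `f`.
    have hpt : ∀ᵐ x ∂μ, f x ^ (θ / 2) ≤ 1 + ∑' k : ℕ,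
        {x | ENNReal.ofReal (2 ^ k) ≤ f x}.indicator
          (fun _ => ENNReal.ofReal ((2 ^ (k + 1)) ^ (θ / 2))) x := by
      filter_upwards [hac.ae_le (Measure.rnDeriv_lt_top μ vol)] with x hx
      rcases le_or_gt (f x) 1 with h1 | h1
      · exact (ENNReal.rpow_le_one h1 (by positivity)).trans le_self_add
      · have hfx : f x = ENNReal.ofReal (f x).toReal := (ENNReal.ofReal_toReal hx.ne).symm
        have h1' : 1 ≤ (f x).toReal := by
          rw [hfx, ENNReal.one_lt_ofReal] at h1; exact h1.le
        obtain ⟨k, hk1, hk2⟩ := exists_nat_pow_near h1' one_lt_two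
        refine le_trans ?_ ((ENNReal.le_tsum k).trans le_add_self)
        rw [indicator_of_mem (show x ∈ {x | ENNReal.ofReal (2 ^ k) ≤ f x} by
          rw [mem_ofPred_eq, hfx]; exact ENNReal.ofReal_le_ofReal hk1)]
        rw [hfx, ENNReal.ofReal_rpow_of_nonneg (by positivity) (by positivity)]
        exact ENNReal.ofReal_le_ofReal (by gcongr)
    have hmeas : ∀ k : ℕ, MeasurableSet {x | ENNReal.ofReal (2 ^ k) ≤ f x} := fun k =>
      measurableSet_le measurable_const hfm
    have hgeom : Summable fun k : ℕ => ((2 : ℝ) ^ (-(θ / 2))) ^ k := by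
      refine summable_geometric_of_lt_one (by positivity) ?_
      exact Real.rpow_lt_one_of_one_lt_of_neg one_lt_two (by linarith)
    calc ∫⁻ x, f x ^ (θ / 2) ∂μ ≤ _ := lintegral_mono_ae hpt
      _ = 1 + ∑' k : ℕ, ENNReal.ofReal ((2 ^ (k + 1)) ^ (θ / 2))
            * μ {x | ENNReal.ofReal (2 ^ k) ≤ f x} := by
          rw [lintegral_add_left measurable_const, lintegral_const, measure_univ, one_mul,
            lintegral_tsum fun k => (measurable_const.indicator (hmeas k)).aemeasurable]
          simp_rw [lintegral_indicator_const (hmeas _)]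
      _ ≤ 1 + ∑' k : ℕ, ENNReal.ofReal C
            * ENNReal.ofReal (2 ^ (θ / 2) * ((2 : ℝ) ^ (-(θ / 2))) ^ k) := by
          refine add_le_add le_rfl (ENNReal.tsum_le_tsum fun k => ?_)
          refine (mul_le_mul' le_rfl (hlevel _ (by positivity))).trans (le_of_eq ?_)
          rw [mul_left_comm, ← ENNReal.ofReal_mul (by positivity)]
          congr 2
          rw [← Real.rpow_natCast, ← Real.rpow_natCast, ← Real.rpow_natCast, ← Real.rpow_mul,
            ← Real.rpow_mul, ← Real.rpow_mul, ← Real.rpow_add, ← Real.rpow_add]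
          · congr 1; push_cast; ring
          all_goals norm_num
      _ < ∞ := by
          rw [ENNReal.tsum_mul_left, ← ENNReal.ofReal_tsum_of_nonneg (fun k => by positivity)
            (hgeom.mul_left _)]
          exact ENNReal.add_lt_top.2 ⟨ENNReal.one_lt_top,
            ENNReal.mul_lt_top ENNReal.ofReal_lt_top ENNReal.ofReal_lt_top⟩
  refine ⟨hfm.ennreal_toReal.aestronglyMeasurable, ?_⟩
  have hq : (0 : ℝ) < 1 + θ / 2 := by positivity
  rw [eLpNorm_lt_top_iff_lintegral_rpow_enorm_lt_top (by simpa using hq) ENNReal.ofReal_ne_top,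
    ENNReal.toReal_ofReal hq.le]
  refine lt_of_le_of_lt ?_ hmoment
  have hm : Measurable fun x => f x ^ (θ / 2) := hfm.pow_const _
  conv_rhs => rw [← hμf]
  rw [lintegral_withDensity_eq_lintegral_mul _ hfm hm]
  refine lintegral_mono fun x => ?_
  calc _ ≤ f x ^ (1 + θ / 2) := by
        refine ENNReal.rpow_le_rpow ?_ hq.le
        rw [Real.enorm_of_nonneg ENNReal.toReal_nonneg]
        exact ENNReal.ofReal_toReal_le
    _ = _ := by
        rw [Pi.mul_apply, ENNReal.rpow_add_of_nonneg _ _ zero_le_one (by positivity),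
          ENNReal.rpow_one]

/-! ### Self-similar measures on Euclidean space -/

/-- The law `∑ pᵢ δ_{aᵢ}` of one digit of the self-similar measure. -/
noncomputable def digitMeasure {d m : ℕ} (a : Fin m → EuclideanSpace ℝ (Fin d))
    (p : Fin m → ℝ) : Measure (EuclideanSpace ℝ (Fin d)) :=
  ∑ i, ENNReal.ofReal (p i) • Measure.dirac (a i)

theorem isProbabilityMeasure_digitMeasure {d m : ℕ} (a : Fin m → EuclideanSpace ℝ (Fin d))
    {p : Fin m → ℝ} (hp : IsPositiveProbVector p) : IsProbabilityMeasure (digitMeasure a p) := by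
  refine ⟨?_⟩
  simp only [digitMeasure, Measure.finsetSum_apply, Measure.smul_apply, measure_univ, smul_eq_mul,
    mul_one]
  rw [← ENNReal.ofReal_sum_of_nonneg fun i _ => (hp.1 i).le, hp.2, ENNReal.ofReal_one]

theorem digitMeasure_compl_closedBall {d m : ℕ} (a : Fin m → EuclideanSpace ℝ (Fin d))
    (p : Fin m → ℝ) : digitMeasure a p (closedBall 0 (∑ i, ‖a i‖))ᶜ = 0 := by
  simp only [digitMeasure, Measure.finsetSum_apply, Measure.smul_apply]
  refine Finset.sum_eq_zero fun i _ => ?_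
  have : a i ∈ closedBall (0 : EuclideanSpace ℝ (Fin d)) (∑ i, ‖a i‖) :=
    mem_closedBall_zero_iff.2
      (Finset.single_le_sum (f := fun i => ‖a i‖) (fun _ _ => norm_nonneg _) (Finset.mem_univ i))
  simp [Measure.dirac_apply' _ (measurableSet_closedBall.compl), this]

theorem eq_digitMeasure_conv {d m : ℕ}
    {T : EuclideanSpace ℝ (Fin d) →ₗ[ℝ] EuclideanSpace ℝ (Fin d)}
    {a : Fin m → EuclideanSpace ℝ (Fin d)} {p : Fin m → ℝ}
    {ν : Measure (EuclideanSpace ℝ (Fin d))} (hν : IsSelfSimilarMeasure T a p ν) :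
    ν = (digitMeasure a p).conv (ν.map T) := by
  have := hν.isProbabilityMeasure
  have hT : Measurable T := (LinearMap.continuous_of_finiteDimensional T).measurable
  have := Measure.isProbabilityMeasure_map (μ := ν) hT.aemeasurable
  ext s hs
  conv_lhs => rw [hν.invariant]
  rw [← lintegral_indicator_one hs (μ := (digitMeasure a p).conv (ν.map T)),
    Measure.lintegral_conv (measurable_one.indicator hs), digitMeasure,
    lintegral_finsetSum_measure, Measure.finsetSum_apply]
  refine Finset.sum_congr rfl fun i _ => ?_
  have hm : Measurable fun y => s.indicator (1 : EuclideanSpace ℝ (Fin d) → ℝ≥0∞) (a i + y) :=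
    (measurable_one.indicator hs).comp (measurable_const_add (a i))
  rw [lintegral_smul_measure, lintegral_dirac, lintegral_map hm hT, Measure.smul_apply,
    Measure.map_apply (hT.add_const _) hs, ← lintegral_indicator_one ((hT.add_const _) hs)]
  congr 1
  refine lintegral_congr fun x => ?_
  rw [add_comm]
  rfl

/-- The power bound for `ν ∗ η`: the large deviation estimate for `ν` with an exponent
`u ∈ (d - 2σ, d)`, combined with the decay of the Fourier transform of `η`. -/
theorem exists_conv_le_rpow {d m : ℕ}
    {T : EuclideanSpace ℝ (Fin d) →ₗ[ℝ] EuclideanSpace ℝ (Fin d)}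
    (hT : IsContractiveSimilarity T)
    {a : Fin m → EuclideanSpace ℝ (Fin d)} {p : Fin m → ℝ} (hp : IsPositiveProbVector p)
    {ν : Measure (EuclideanSpace ℝ (Fin d))} (hν : IsSelfSimilarMeasure T a p ν)
    (hdim : measureDimH ν = (d : ℝ≥0∞))
    {η : Measure (EuclideanSpace ℝ (Fin d))} [IsProbabilityMeasure η]
    (hη : HasPowerFourierDecay η) :
    ∃ C θ : ℝ, 0 < θ ∧ ∀ A, ν.conv η A ≤ ENNReal.ofReal C * volume A ^ θ := by
  have := hν.isProbabilityMeasure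
  -- In dimension `0` there is no exponent `0 ≤ u < d`, but Lebesgue measure is a point mass.
  rcases Nat.eq_zero_or_pos d with rfl | hd
  · refine ⟨1, 1, one_pos, fun A => ?_⟩
    rw [ENNReal.ofReal_one, one_mul, ENNReal.rpow_one]
    rcases A.eq_empty_or_nonempty with rfl | ⟨x, hx⟩
    · simp
    · have h0 : (0 : EuclideanSpace ℝ (Fin 0)) ∈ A := by rwa [Subsingleton.elim 0 x]
      rw [volume_euclideanSpace_eq_dirac, Measure.dirac_apply_of_mem h0]
      exact prob_le_one
  obtain ⟨r, hr0, hr1, hr⟩ := hT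
  obtain ⟨σ, hσ, C, hC⟩ := hη
  have := isProbabilityMeasure_digitMeasure a hp
  have hd' : (0 : ℝ) < d := by exact_mod_cast hd
  -- An exponent `u < d` with `d < u + 2σ`.
  obtain ⟨u, hu, hud⟩ := exists_between (max_lt hd' (by linarith : (d : ℝ) - 2 * σ < d))
  have hu0 : 0 < u := (le_max_left _ _).trans_lt hu
  have huσ : (d : ℝ) - 2 * σ < u := (le_max_right _ _).trans_lt hu
  have hfin : Module.finrank ℝ (EuclideanSpace ℝ (Fin d)) = d := by simp
  have hdim' : ∀ A : Set (EuclideanSpace ℝ (Fin d)), MeasurableSet A → 0 < ν A →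
      ENNReal.ofReal (Module.finrank ℝ (EuclideanSpace ℝ (Fin d))) ≤ dimH A := by
    intro A hA hpos
    rw [hfin, ENNReal.ofReal_natCast, ← hdim]
    exact iInf_le_of_le A (iInf_le_of_le hA (iInf_le _ hpos))
  have hη' : ∀ ξ : EuclideanSpace ℝ (Fin d), ξ ≠ 0 →
      ‖charFun η ((2 * Real.pi) • ξ)‖ ≤ C * 2 ^ (-σ) * ‖ξ‖ ^ (-σ) := by
    intro ξ hξ
    have h1 : measureFourier η ((2 : ℝ) • ξ) = charFun η ((2 * Real.pi) • ξ) := by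
      rw [measureFourier, charFun_apply]
      congr 1
      ext x
      congr 1
      rw [inner_smul_right, inner_smul_right]
      push_cast
      ring
    have h2 := hC ((2 : ℝ) • ξ) (smul_ne_zero two_ne_zero hξ)
    rw [h1, norm_smul, Real.norm_of_nonneg zero_le_two,
      Real.mul_rpow zero_le_two (norm_nonneg _)] at h2
    rwa [mul_assoc]
  obtain ⟨ρ, δ, K, hρ0, hρ1, hδ, hK, hdev⟩ := exists_measure_lt_measure_ball_le hr0 hr1 hr
    (eq_digitMeasure_conv hν) (digitMeasure_compl_closedBall a p) hdim' hu0.le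
    (by rw [hfin]; exact hud)
  obtain ⟨K₁, K₂, hK₁, hK₂, hsplit⟩ := exists_conv_apply_le hσ hη' hρ0 hρ1 hδ hK hu0.le
    (by rw [hfin]; linarith) hdev
  exact exists_measure_le_rpow hρ0 hρ1 hδ hu0 hK₁ hK₂ hsplit

end SelfSimilarConv

theorem mainTheorem11 {d m : ℕ}
    (T : EuclideanSpace ℝ (Fin d) →ₗ[ℝ] EuclideanSpace ℝ (Fin d))
    (hT : IsContractiveSimilarity T)
    (a : Fin m → EuclideanSpace ℝ (Fin d))
    (p : Fin m → ℝ) (hp : IsPositiveProbVector p)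
    (ν : Measure (EuclideanSpace ℝ (Fin d))) (hν : IsSelfSimilarMeasure T a p ν)
    (hdim : measureDimH ν = (d : ℝ≥0∞))
    (η : Measure (EuclideanSpace ℝ (Fin d))) [IsProbabilityMeasure η]
    (hη : HasPowerFourierDecay η) :
    Measure.conv ν η ≪ volume ∧
      ∃ q : ℝ, 1 < q ∧
        MemLp (fun x => ((Measure.conv ν η).rnDeriv volume x).toReal)
          (ENNReal.ofReal q) volume := by
  have := hν.isProbabilityMeasure
  obtain ⟨C, θ, hθ, h⟩ := SelfSimilarConv.exists_conv_le_rpow hT hp hν hdim hη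
  exact SelfSimilarConv.absolutelyContinuous_and_memLp_of_measure_le_rpow hθ h
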